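/- Let $\beta>1$ be a real number and $I=[0,1)$. Let $T_\beta\colon I\to I$, $T_\beta(x)=\beta x-\lfloor\beta x\rfloor$, be the $\beta$-transformation, and for $x\in I$ and $n\ge1$ let $\varepsilon_n(x,\beta)=\lfloor\beta T_\beta^{n-1}(x)\rfloor$ be the $n$-th digit of $x$ in base $\beta$. For $y\in I$ let \[I_n(y)=\{z\in I\colon \varepsilon_i(z,\beta)=\varepsilon_i(y,\beta)\text{ for }1\le i\le n\}\] be the basic interval of order $n$ containing $y$, and for $x,y\in I$ let \[W_n^\beta(x,y)=\inf\{k\ge1\colon T_\beta^kx\in I_n(y)\}\in\{1,2,\dots\}\cup\{\infty\}\] be the waiting time (with $\inf\emptyset=\infty$ and $\log\infty=\infty$). Define the lower and upper quantitative waiting time indicators \[\underline R^\beta(x,y)=\liminf_{n\to\infty}\frac{\log W_n^\beta(x,y)}{n},\qquad \overline R^\beta(x,y)=\limsup_{n\to\infty}\frac{\log W_n^\beta(x,y)}{n}\] in $[0,\infty]$. Then, for all $0\le a\le b\le\infty$, the set \[E_\beta(a,b)=\{(x,y)\in I^2\colon \underline R^\beta(x,y)=a,\ \overline R^\beta(x,y)=b\}\]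 has Hausdorff dimension $2$. -/

import Mathlib

noncomputable section

namespace BetaWaiting

/-- The `β`-transformation `x ↦ βx - ⌊βx⌋` (it maps `[0,1)` into itself). -/
def betaMap (β x : ℝ) : ℝ := β * x - ⌊β * x⌋

/-- The `n`-th digit (`n ≥ 1`) of `x` in base `β`: the integer part of `β T^{n-1} x`. -/
def digit (β x : ℝ) (n : ℕ) : ℤ := ⌊β * (betaMap β)^[n - 1] x⌋

/-- The basic interval `I_n(y)` of order `n` containing `y`: the points of `[0,1)` whose first
`n` digits are those of `y`. -/
def basicInterval (β : ℝ) (n : ℕ) (y : ℝ) : Set ℝ :=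
  {z | z ∈ Set.Ico (0 : ℝ) 1 ∧ ∀ i, 1 ≤ i → i ≤ n → digit β z i = digit β y i}

/-- The waiting time `inf {k ≥ 1 : T^k x ∈ I_n(y)}`; it is `⊤` if there is no such `k`. -/
def waitingTime (β : ℝ) (n : ℕ) (x y : ℝ) : ℕ∞ :=
  ⨅ (k : ℕ) (_ : 1 ≤ k ∧ (betaMap β)^[k] x ∈ basicInterval β n y), (k : ℕ∞)

/-- `log W_n(x,y) / n`, as an extended real (`log ∞ = ∞`). -/
def waitingRate (β x y : ℝ) (n : ℕ) : EReal :=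
  ENNReal.log (waitingTime β n x y : ENNReal) / (n : EReal)

/-- The lower quantitative waiting time indicator. If some `W_n(x,y)` is infinite, then so are
all later ones, hence this is `⊤`, and the same holds for the upper indicator. -/
def lowerIndicator (β x y : ℝ) : EReal :=
  Filter.liminf (waitingRate β x y) Filter.atTop

/-- The upper quantitative waiting time indicator. -/
def upperIndicator (β x y : ℝ) : EReal :=
  Filter.limsup (waitingRate β x y) Filter.atTop

/-- The planar waiting set `E_β(a,b)`. The product metric of `ℝ × ℝ` is bi-Lipschitz equivalent
to the Euclidean one, so that it gives the same Hausdorff dimensions. -/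
def waitingSet (β : ℝ) (a b : EReal) : Set (ℝ × ℝ) :=
  {p | p.1 ∈ Set.Ico (0 : ℝ) 1 ∧ p.2 ∈ Set.Ico (0 : ℝ) 1 ∧
    lowerIndicator β p.1 p.2 = a ∧ upperIndicator β p.1 p.2 = b}

end BetaWaiting

end

noncomputable section

namespace BetaWaiting

open Set Filter Topology

variable {β : ℝ}

/-! The upper bound is the dimension of the plane. For the lower bound, each s < 1 yields a subset
of the waiting set of dimension at least 2s², and s tends to 1.

The β-shift is first replaced by a full shift. If T^m maps a basic interval of order m onto [0, 1),
its word may be followed by any admissible word. By `pow_le_mul_ncard_isFull` there are at least β^m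
/ (m + 1) such words; with a digit 0 put in front, they supply, for a suitable m, N ≥ β^(ms) freely
concatenable letters of length m (`exists_letters`).

Given free letters ξ and η, let y be 0 0 η₀ η₁ …, and let x spell out ξ, interrupted at block Q n by
0 0 η₀ … ηₙ t. The letter 0 occurs nowhere else in x and t does not occur in η, so the orbit of x
enters long basic intervals of y only at times Q n · m, and the match there lasts at least n + 3 but
fewer than n + 4 blocks (`eq_mul_of_iterate_mem_basicInterval`). Hence Q alone governs the
indicators. It is taken of size exp (h (m n)) up to polynomial factors, where h n / n has lower
limit a and upper limit b (`exists_growth_with_stable_limits`).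

As Q grows at least cubically, the insertions have density zero and cost no dimension: reading ξ and
η as base N expansions sends the pairs (x, y) onto the unit square, with Hölder exponent s²
(`two_mul_le_dimH_waitingSet`). -/

/-! ### Affine pieces and full basic intervals -/

theorem betaMap_mem_Ico (β x : ℝ) : betaMap β x ∈ Ico (0 : ℝ) 1 := by
  unfold betaMap
  exact ⟨Int.fract_nonneg _, Int.fract_lt_one _⟩

theorem iterate_betaMap_mem_Ico {x : ℝ} (hx : x ∈ Ico (0 : ℝ) 1) (k : ℕ) :
    (betaMap β)^[k] x ∈ Ico (0 : ℝ) 1 := by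
  cases k with
  | zero => exact hx
  | succ k => rw [Function.iterate_succ_apply']; exact betaMap_mem_Ico _ _

theorem betaMap_zero (β : ℝ) : betaMap β 0 = 0 := by simp [betaMap]

theorem iterate_betaMap_zero (β : ℝ) (k : ℕ) : (betaMap β)^[k] 0 = 0 :=
  Function.iterate_fixed (betaMap_zero β) k

theorem floor_mul_add_of_betaMap_add_lt_one (hβ : 0 ≤ β) {w v : ℝ} (hv : 0 ≤ v)
    (h : betaMap β w + β * v < 1) : ⌊β * (w + v)⌋ = ⌊β * w⌋ := by
  rw [Int.floor_eq_iff, mul_add]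
  unfold betaMap at h
  have := Int.floor_le (β * w)
  have := mul_nonneg hβ hv
  constructor <;> linarith

theorem betaMap_add (hβ : 0 ≤ β) {w v : ℝ} (hv : 0 ≤ v) (h : betaMap β w + β * v < 1) :
    betaMap β (w + v) = betaMap β w + β * v := by
  have := floor_mul_add_of_betaMap_add_lt_one hβ hv h
  unfold betaMap
  rw [this]
  ring

/-- On `[c, c + r)` the first `k` iterates of the `β`-transformation are increasing and affine. -/
def IsAffinePiece (β : ℝ) (k : ℕ) (c r : ℝ) : Prop :=
  0 ≤ c ∧ ∀ i ≤ k, (betaMap β)^[i] c + β ^ i * r ≤ 1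

theorem IsAffinePiece.iterate_add (hβ : 0 < β) {k : ℕ} {c r u : ℝ} (h : IsAffinePiece β k c r)
    (hu : 0 ≤ u) (hur : u < r) {i : ℕ} (hi : i ≤ k) :
    (betaMap β)^[i] (c + u) = (betaMap β)^[i] c + β ^ i * u := by
  induction i with
  | zero => simp
  | succ i ih =>
    have h1 := h.2 (i + 1) hi
    have h2 : β ^ (i + 1) * u < β ^ (i + 1) * r := by gcongr
    rw [Function.iterate_succ_apply', ih (by omega), Function.iterate_succ_apply',
      betaMap_add hβ.le (by positivity), pow_succ']
    · ring
    · rw [← Function.iterate_succ_apply' (f := betaMap β), ← mul_assoc, ← pow_succ']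
      linarith

theorem IsAffinePiece.floor_iterate_add (hβ : 0 < β) {k : ℕ} {c r u : ℝ}
    (h : IsAffinePiece β k c r) (hu : 0 ≤ u) (hur : u < r) {i : ℕ} (hi : i < k) :
    ⌊β * (betaMap β)^[i] (c + u)⌋ = ⌊β * (betaMap β)^[i] c⌋ := by
  rw [h.iterate_add hβ hu hur hi.le]
  refine floor_mul_add_of_betaMap_add_lt_one hβ.le (by positivity) ?_
  have h1 := h.2 (i + 1) hi
  have h2 : β ^ (i + 1) * u < β ^ (i + 1) * r := by gcongr
  rw [← Function.iterate_succ_apply' (f := betaMap β), ← mul_assoc, ← pow_succ']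
  linarith

/-- `c` is the left endpoint of a full basic interval `[c, c + β⁻ᵐ)` of order `m`, that is of one
which the `m`-th iterate maps onto `[0, 1)`. -/
def IsFull (β : ℝ) (m : ℕ) (c : ℝ) : Prop := IsAffinePiece β m c (β ^ m)⁻¹

theorem IsFull.iterate_eq_zero (hβ : 0 < β) {m : ℕ} {c : ℝ} (h : IsFull β m c) :
    (betaMap β)^[m] c = 0 := by
  have h1 := h.2 m le_rfl
  rw [mul_inv_cancel₀ (by positivity)] at h1
  have h0 := h.2 0 (Nat.zero_le _)
  have : 0 < (β ^ m)⁻¹ := by positivity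
  simp only [Function.iterate_zero, id, pow_zero, one_mul] at h0
  have := (iterate_betaMap_mem_Ico (β := β) ⟨h.1, by linarith⟩ m).1
  linarith

theorem IsFull.add_le_one {m : ℕ} {c : ℝ} (h : IsFull β m c) : c + (β ^ m)⁻¹ ≤ 1 := by
  simpa using h.2 0 (Nat.zero_le _)

theorem isFull_zero (hβ : 1 < β) (m : ℕ) : IsFull β m 0 := by
  refine ⟨le_rfl, fun i hi => ?_⟩
  rw [iterate_betaMap_zero, zero_add, ← div_eq_mul_inv]
  exact (div_le_one (by positivity)).2 (pow_le_pow_right₀ hβ.le hi)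

theorem IsFull.iterate_add_div (hβ : 0 < β) {j : ℕ} {c t : ℝ} (h : IsFull β j c)
    (ht : t ∈ Ico (0 : ℝ) 1) {i : ℕ} (hi : i ≤ j) :
    (betaMap β)^[i] (c + t / β ^ j) = (betaMap β)^[i] c + β ^ i * (t / β ^ j) := by
  refine IsAffinePiece.iterate_add hβ h (div_nonneg ht.1 (by positivity)) ?_ hi
  rw [div_eq_mul_inv]
  exact mul_lt_of_lt_one_left (by positivity) ht.2

theorem IsFull.iterate_self_add_div (hβ : 0 < β) {j : ℕ} {c t : ℝ} (h : IsFull β j c)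
    (ht : t ∈ Ico (0 : ℝ) 1) : (betaMap β)^[j] (c + t / β ^ j) = t := by
  rw [h.iterate_add_div hβ ht le_rfl, h.iterate_eq_zero hβ, zero_add,
    mul_div_cancel₀ _ (by positivity)]

/-- Concatenation of full words: the j-th iterate carries the new point to `c'`, so the bounds of
`c` serve up to time j and those of `c'` afterwards. -/
theorem IsFull.add_div (hβ : 1 < β) {j k : ℕ} {c c' : ℝ} (h : IsFull β j c) (h' : IsFull β k c') :
    IsFull β (j + k) (c + c' / β ^ j) := by
  have hβ0 : 0 < β := by linarith
  have hc' : c' ∈ Ico (0 : ℝ) 1 := by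
    have : 0 < (β ^ k)⁻¹ := by positivity
    exact ⟨h'.1, by linarith [h'.add_le_one]⟩
  refine ⟨add_nonneg h.1 (div_nonneg hc'.1 (by positivity)), fun i hi => ?_⟩
  rcases le_total i j with hij | hij
  · rw [h.iterate_add_div hβ0 hc' hij]
    have h1 := h.2 i hij
    have h2 : β ^ i * ((β ^ j)⁻¹ * (c' + (β ^ k)⁻¹)) ≤ β ^ i * ((β ^ j)⁻¹ * 1) := by
      gcongr
      exact h'.add_le_one
    rw [pow_add, mul_inv, div_eq_mul_inv]
    linarith
  · obtain ⟨l, rfl⟩ := Nat.exists_eq_add_of_le hij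
    rw [add_comm j l, Function.iterate_add_apply, h.iterate_self_add_div hβ0 hc']
    have h1 := h'.2 l (by omega)
    have : β ^ (l + j) * (β ^ (j + k))⁻¹ = β ^ l * (β ^ k)⁻¹ := by
      rw [pow_add, pow_add]
      field_simp
    linarith

/-- Append zero digits, since 0 starts a full interval of every order. -/
theorem IsFull.mono (hβ : 1 < β) {j m : ℕ} (hjm : j ≤ m) {c : ℝ} (h : IsFull β j c) :
    IsFull β m c := by
  obtain ⟨k, rfl⟩ := Nat.exists_eq_add_of_le hjm
  simpa using h.add_div hβ (isFull_zero hβ k)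

/-- On the interval of `c` the m-th iterate increases strictly from 0, so it cannot vanish again at
`c'`. -/
theorem IsFull.add_le_of_lt (hβ : 0 < β) {m : ℕ} {c c' : ℝ} (h : IsFull β m c) (h' : IsFull β m c')
    (hlt : c < c') : c + (β ^ m)⁻¹ ≤ c' := by
  by_contra! hcon
  have := IsAffinePiece.iterate_add hβ h (u := c' - c) (by linarith) (by linarith) le_rfl
  rw [add_sub_cancel, h.iterate_eq_zero hβ, h'.iterate_eq_zero hβ] at this
  have : 0 < β ^ m * (c' - c) := mul_pos (by positivity) (by linarith)
  linarith

theorem IsFull.inv_le_abs_sub (hβ : 0 < β) {m : ℕ} {c c' : ℝ} (h : IsFull β m c)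
    (h' : IsFull β m c') (hne : c ≠ c') : (β ^ m)⁻¹ ≤ |c - c'| := by
  rcases lt_or_gt_of_ne hne with hlt | hlt
  · rw [abs_sub_comm]
    exact le_trans (by linarith [h.add_le_of_lt hβ h' hlt]) (le_abs_self _)
  · exact le_trans (by linarith [h'.add_le_of_lt hβ h hlt]) (le_abs_self _)

theorem finite_setOf_isFull (hβ : 0 < β) (m : ℕ) : {c | IsFull β m c}.Finite := by
  have hpos : 0 < β ^ m := by positivity
  refine Finite.of_finite_image (f := fun c : ℝ => ⌊β ^ m * c⌋)
    ((finite_Icc 0 ⌊β ^ m⌋).subset ?_) ?_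
  · rintro _ ⟨c, hc, rfl⟩
    have h1 : c ≤ 1 := by
      have : 0 < (β ^ m)⁻¹ := by positivity
      linarith [IsFull.add_le_one hc]
    exact ⟨Int.floor_nonneg.2 (mul_nonneg hpos.le hc.1),
      Int.floor_le_floor (mul_le_of_le_one_right hpos.le h1)⟩
  · intro c hc c' hc' heq
    by_contra hne
    have h1 := IsFull.inv_le_abs_sub hβ hc hc' hne
    have h2 := Int.abs_sub_lt_one_of_floor_eq_floor heq
    rw [← mul_sub, abs_mul, abs_of_pos hpos] at h2
    have : β ^ m * (β ^ m)⁻¹ ≤ β ^ m * |c - c'| := by gcongr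
    rw [mul_inv_cancel₀ hpos.ne'] at this
    linarith

/-! ### Counting full intervals -/

/-- `s` is the left endpoint of the part of `[0, 1)` outside all full basic intervals of
orders `1, …, k`. -/
structure IsTailStart (β : ℝ) (k : ℕ) (s : ℝ) : Prop where
  le_one : s ≤ 1
  piece : IsAffinePiece β k s (1 - s)
  iterate_eq_zero : s < 1 → (betaMap β)^[k] s = 0

/-- On the tail T^k is u ↦ β^k u, measured from `s`, so T^(k+1) is the fractional part of β^(k+1) u.
Its complete branches are full intervals of order k + 1, laid side by side from `s`; the incomplete
last branch is the new tail. -/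
theorem IsTailStart.exists_succ (hβ : 1 < β) {k : ℕ} {s : ℝ} (h : IsTailStart β k s) :
    ∃ s', IsTailStart β (k + 1) s' ∧ ∀ t, s ≤ t → t < s' →
      ∃ c, IsFull β (k + 1) c ∧ c ≤ t ∧ t < c + (β ^ (k + 1))⁻¹ := by
  have hβ0 : 0 < β := by linarith
  have hpos : 0 < β ^ (k + 1) := by positivity
  rcases h.le_one.eq_or_lt with rfl | hs1
  · refine ⟨1, ⟨le_rfl, ⟨zero_le_one, fun i _ => ?_⟩, fun h => absurd h (lt_irrefl _)⟩,
      fun t h1 h2 => absurd h1 (not_le.2 h2)⟩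
    cases i with
    | zero => simp
    | succ i =>
      rw [Function.iterate_succ_apply']
      have := (betaMap_mem_Ico β ((betaMap β)^[i] 1)).2
      linarith
  have hz := h.iterate_eq_zero hs1
  -- the points `s + l β^{-(k+1)}` strictly below `1`
  have key : ∀ l : ℕ, s + l / β ^ (k + 1) < 1 → (∀ i ≤ k,
      (betaMap β)^[i] (s + l / β ^ (k + 1)) = (betaMap β)^[i] s + β ^ i * (l / β ^ (k + 1))) ∧
      (betaMap β)^[k + 1] (s + l / β ^ (k + 1)) = 0 := by
    intro l hl
    have h1 : ∀ i ≤ k, (betaMap β)^[i] (s + l / β ^ (k + 1)) =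
        (betaMap β)^[i] s + β ^ i * (l / β ^ (k + 1)) := fun i hi =>
      h.piece.iterate_add hβ0 (by positivity) (by linarith) hi
    refine ⟨h1, ?_⟩
    rw [Function.iterate_succ_apply', h1 k le_rfl, hz, zero_add, betaMap]
    have : β * (β ^ k * (l / β ^ (k + 1))) = (l : ℝ) := by
      rw [pow_succ']; field_simp
    rw [this]; simp
  set r := β ^ (k + 1) * (1 - s) with hr
  have hr0 : 0 ≤ r := mul_nonneg hpos.le (by linarith)
  have hfl : (⌊r⌋₊ : ℝ) ≤ r := Nat.floor_le hr0
  have hs' : s + ⌊r⌋₊ / β ^ (k + 1) ≤ 1 := by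
    have : (⌊r⌋₊ : ℝ) / β ^ (k + 1) ≤ 1 - s := by rw [div_le_iff₀ hpos]; linarith
    linarith
  refine ⟨s + ⌊r⌋₊ / β ^ (k + 1), ⟨hs', ⟨add_nonneg h.piece.1 (by positivity), fun i hi => ?_⟩,
    fun hlt => (key _ hlt).2⟩, fun t ht1 ht2 => ?_⟩
  · rcases hs'.eq_or_lt with heq | hlt
    · rw [heq, sub_self, mul_zero, add_zero]
      cases i with
      | zero => simp
      | succ i =>
        rw [Function.iterate_succ_apply']
        exact (betaMap_mem_Ico β _).2.le
    · rcases Nat.lt_or_ge k i with hki | hki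
      · obtain rfl : i = k + 1 := by omega
        rw [(key _ hlt).2]
        have := Nat.lt_floor_add_one r
        have h2 : β ^ (k + 1) * (1 - (s + ⌊r⌋₊ / β ^ (k + 1))) = r - ⌊r⌋₊ := by
          rw [hr]; field_simp; ring
        linarith
      · rw [(key _ hlt).1 i hki]
        have := h.piece.2 i hki
        linarith
  · set l := ⌊β ^ (k + 1) * (t - s)⌋₊ with hl
    have hu0 : 0 ≤ β ^ (k + 1) * (t - s) := mul_nonneg hpos.le (by linarith)
    have hl1 : (l : ℝ) ≤ β ^ (k + 1) * (t - s) := Nat.floor_le hu0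
    have hl2 : β ^ (k + 1) * (t - s) < l + 1 := Nat.lt_floor_add_one _
    have hlr : l + 1 ≤ ⌊r⌋₊ := by
      have : (l : ℝ) < ⌊r⌋₊ := by
        have : t - s < ⌊r⌋₊ / β ^ (k + 1) := by linarith
        rw [lt_div_iff₀ hpos] at this
        linarith
      exact_mod_cast this
    have hlr' : ((l : ℝ) + 1) ≤ ⌊r⌋₊ := by exact_mod_cast hlr
    have hct : s + l / β ^ (k + 1) ≤ t := by
      have : (l : ℝ) / β ^ (k + 1) ≤ t - s := by rw [div_le_iff₀ hpos]; linarith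
      linarith
    have htc : t < s + l / β ^ (k + 1) + (β ^ (k + 1))⁻¹ := by
      have : t - s < (l + 1 : ℝ) / β ^ (k + 1) := by rw [lt_div_iff₀ hpos]; linarith
      rw [_root_.add_div, one_div] at this
      linarith
    have hc1 : s + l / β ^ (k + 1) < 1 := by linarith
    refine ⟨s + l / β ^ (k + 1), ⟨add_nonneg h.piece.1 (by positivity), fun i hi => ?_⟩, hct, htc⟩
    rcases Nat.lt_or_ge k i with hki | hki
    · obtain rfl : i = k + 1 := by omega
      rw [(key _ hc1).2, mul_inv_cancel₀ hpos.ne']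
      simp
    · rw [(key _ hc1).1 i hki]
      have h1 := h.piece.2 i hki
      have h2 : β ^ i * (((l : ℝ) + 1) / β ^ (k + 1)) ≤ β ^ i * (1 - s) := by
        gcongr
        rw [div_le_iff₀ hpos]
        linarith
      rw [_root_.add_div, one_div] at h2
      linarith

theorem exists_tailStart_sequence (hβ : 1 < β) : ∃ s : ℕ → ℝ, s 0 = 0 ∧
    (∀ k, IsTailStart β k (s k)) ∧ ∀ k t, s k ≤ t → t < s (k + 1) →
      ∃ c, IsFull β (k + 1) c ∧ c ≤ t ∧ t < c + (β ^ (k + 1))⁻¹ := by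
  have h0 : IsTailStart β 0 0 := by
    refine ⟨zero_le_one, ⟨le_rfl, fun i hi => ?_⟩, fun _ => rfl⟩
    obtain rfl : i = 0 := by omega
    simp
  choose f hf hf' using fun (k : ℕ) (s : {s : ℝ // IsTailStart β k s}) =>
    IsTailStart.exists_succ hβ s.2
  let g : ∀ k, {s : ℝ // IsTailStart β k s} := fun k =>
    Nat.rec ⟨0, h0⟩ (fun k s => ⟨f k s, hf k s⟩) k
  exact ⟨fun k => (g k).1, rfl, fun k => (g k).2, fun k => hf' k (g k)⟩

/-- Every point of `[0, 1)` lies, for some `j ≤ m`, in the tail of order `m - j` of a full basic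
interval of order `j`. -/
theorem exists_isFull_tail (hβ : 1 < β) {s : ℕ → ℝ} (hs0 : s 0 = 0)
    (hs : ∀ k t, s k ≤ t → t < s (k + 1) →
      ∃ c, IsFull β (k + 1) c ∧ c ≤ t ∧ t < c + (β ^ (k + 1))⁻¹)
    (m : ℕ) {x : ℝ} (hx : x ∈ Ico (0 : ℝ) 1) :
    ∃ j ≤ m, ∃ c, IsFull β j c ∧ ∃ t ∈ Ico (s (m - j)) 1, 0 ≤ t ∧ x = c + t / β ^ j := by
  have hβ0 : 0 < β := by linarith
  induction m with
  | zero => exact ⟨0, le_rfl, 0, isFull_zero hβ 0, x, by simpa [hs0] using hx, hx.1, by simp⟩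
  | succ m ih =>
    obtain ⟨j, hj, c, hc, t, ht, ht0, rfl⟩ := ih
    rcases le_or_gt (s (m - j + 1)) t with hle | hlt
    · refine ⟨j, by omega, c, hc, t, ⟨?_, ht.2⟩, ht0, rfl⟩
      rwa [show m + 1 - j = m - j + 1 by omega]
    · obtain ⟨c', hc', h1, h2⟩ := hs _ t ht.1 hlt
      have hmj : j + (m - j + 1) = m + 1 := by omega
      refine ⟨m + 1, le_rfl, c + c' / β ^ j, hmj ▸ hc.add_div hβ hc',
        (t - c') * β ^ (m - j + 1), ⟨?_, ?_⟩, ?_, ?_⟩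
      · rw [Nat.sub_self, hs0]
        exact mul_nonneg (by linarith) (by positivity)
      · rw [← lt_div_iff₀ (by positivity), one_div]
        linarith
      · exact mul_nonneg (by linarith) (by positivity)
      · rw [← hmj, pow_add]
        field_simp
        ring

open MeasureTheory in
-- The tails of order m - j inside full intervals of order j cover [0, 1). Each has length at most
-- β^(-m), because the iterate of order m is affine on it with values in [0, 1]. Endpoints of order
-- j are also endpoints of order m, which leaves at most m + 1 tails for each endpoint of order m.
theorem pow_le_mul_ncard_isFull (hβ : 1 < β) (m : ℕ) :
    β ^ m ≤ (m + 1) * ({c | IsFull β m c}.ncard : ℝ) := by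
  have hβ0 : 0 < β := by linarith
  obtain ⟨s, hs0, hst, hs⟩ := exists_tailStart_sequence hβ
  set F := (finite_setOf_isFull hβ0 m).toFinset with hF
  have hcard : {c | IsFull β m c}.ncard = F.card := ncard_eq_toFinset_card _ _
  have hcover : Ico (0 : ℝ) 1 ⊆ ⋃ p ∈ Finset.range (m + 1) ×ˢ F,
      Ico (p.2 + s (m - p.1) / β ^ p.1) (p.2 + 1 / β ^ p.1) := by
    intro x hx
    obtain ⟨j, hj, c, hc, t, ht, -, rfl⟩ := exists_isFull_tail hβ hs0 hs m hx
    refine mem_iUnion₂.2 ⟨(j, c), ?_, ?_, ?_⟩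
    · simp only [Finset.mem_product, Finset.mem_range, hF, Finite.mem_toFinset, mem_ofPred_eq]
      exact ⟨by omega, hc.mono hβ hj⟩
    · have := ht.1
      gcongr
    · have := ht.2
      gcongr
  have hvol : ∀ p ∈ Finset.range (m + 1) ×ˢ F,
      volume (Ico (p.2 + s (m - p.1) / β ^ p.1) (p.2 + 1 / β ^ p.1)) ≤
        ENNReal.ofReal (β ^ m)⁻¹ := by
    rintro ⟨j, c⟩ hp
    have hj : j ≤ m := by
      have := (Finset.mem_product.1 hp).1
      simp only [Finset.mem_range] at this
      omega
    rw [Real.volume_Ico]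
    refine ENNReal.ofReal_le_ofReal ?_
    have h1 := (hst (m - j)).piece.2 _ le_rfl
    have h2 : 0 ≤ (betaMap β)^[m - j] (s (m - j)) := by
      rcases (hst (m - j)).le_one.eq_or_lt with h | h
      · rw [h]
        cases (m - j) with
        | zero => simp
        | succ i => rw [Function.iterate_succ_apply']; exact (betaMap_mem_Ico β _).1
      · rw [(hst (m - j)).iterate_eq_zero h]
    have h3 : β ^ (m - j) * (1 - s (m - j)) ≤ 1 := by linarith
    have h4 : β ^ m = β ^ (m - j) * β ^ j := by rw [← pow_add]; congr 1; omega
    simp only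
    rw [h4, add_sub_add_left_eq_sub, ← sub_div, mul_inv, div_eq_mul_inv]
    gcongr
    rw [← one_div, le_div_iff₀ (by positivity)]
    linarith
  have h1 : (1 : ENNReal) ≤ ((m + 1) * F.card : ℕ) * ENNReal.ofReal (β ^ m)⁻¹ := by
    calc (1 : ENNReal) = volume (Ico (0 : ℝ) 1) := by simp
      _ ≤ _ := measure_mono hcover
      _ ≤ _ := measure_biUnion_finset_le _ _
      _ ≤ _ := Finset.sum_le_sum hvol
      _ = _ := by rw [Finset.sum_const, Finset.card_product, Finset.card_range, nsmul_eq_mul]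
  rw [← ENNReal.ofReal_natCast, ← ENNReal.ofReal_mul (by positivity), ENNReal.one_le_ofReal,
    ← div_eq_mul_inv, one_le_div (by positivity)] at h1
  rw [hcard]
  push_cast at h1
  exact h1

/-! ### Digits, letters and their concatenations -/

theorem iterate_sub_iterate {x y : ℝ} {m : ℕ}
    (h : ∀ i < m, ⌊β * (betaMap β)^[i] x⌋ = ⌊β * (betaMap β)^[i] y⌋) :
    (betaMap β)^[m] x - (betaMap β)^[m] y = β ^ m * (x - y) := by
  induction m with
  | zero => simp
  | succ m ih =>
    have h1 := h m (by omega)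
    have h2 := ih fun i hi => h i (by omega)
    rw [Function.iterate_succ_apply', Function.iterate_succ_apply', betaMap, betaMap, h1,
      pow_succ', mul_assoc, ← h2]
    ring

theorem IsFull.eq_of_floor_eq (hβ : 0 < β) {m : ℕ} {c c' : ℝ} (h : IsFull β m c)
    (h' : IsFull β m c')
    (heq : ∀ i < m, ⌊β * (betaMap β)^[i] c⌋ = ⌊β * (betaMap β)^[i] c'⌋) : c = c' := by
  have := iterate_sub_iterate heq
  rw [h.iterate_eq_zero hβ, h'.iterate_eq_zero hβ, sub_zero, zero_eq_mul] at this
  rcases this with h0 | h0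
  · exact absurd h0 (by positivity)
  · linarith

theorem IsFull.exists_floor_ne_zero (hβ : 1 < β) {m : ℕ} {c : ℝ} (h : IsFull β m c) (hc : c ≠ 0) :
    ∃ i < m, ⌊β * (betaMap β)^[i] c⌋ ≠ 0 := by
  by_contra! hcon
  refine hc (h.eq_of_floor_eq (by linarith) (isFull_zero hβ m) fun i hi => ?_)
  rw [hcon i hi, iterate_betaMap_zero]
  simp

theorem iterate_mem_basicInterval_iff {x y : ℝ} (hx : x ∈ Ico (0 : ℝ) 1) {k n : ℕ} :
    (betaMap β)^[k] x ∈ basicInterval β n y ↔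
      ∀ i < n, ⌊β * (betaMap β)^[k + i] x⌋ = ⌊β * (betaMap β)^[i] y⌋ := by
  constructor
  · rintro ⟨-, h⟩ i hi
    have := h (i + 1) (by omega) (by omega)
    rwa [digit, digit, Nat.add_sub_cancel, ← Function.iterate_add_apply, add_comm i k] at this
  · refine fun h => ⟨iterate_betaMap_mem_Ico hx k, fun i hi1 hi => ?_⟩
    have := h (i - 1) (by omega)
    rwa [digit, digit, ← Function.iterate_add_apply, add_comm (i - 1) k]

/-- The left endpoints of the full basic intervals of order `m` with first digit `0`. -/
def IsLetter (β : ℝ) (m : ℕ) (c : ℝ) : Prop := IsFull β m c ∧ c + (β ^ m)⁻¹ ≤ β⁻¹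

theorem IsFull.isLetter_div (hβ : 1 < β) {m : ℕ} {c : ℝ} (h : IsFull β m c) :
    IsLetter β (m + 1) (c / β) := by
  have hβ0 : 0 < β := by linarith
  have h1 := (isFull_zero hβ 1).add_div hβ h
  rw [zero_add, pow_one, add_comm] at h1
  refine ⟨h1, ?_⟩
  rw [pow_succ, mul_inv, div_eq_mul_inv, ← add_mul]
  exact mul_le_of_le_one_left (by positivity) h.add_le_one

theorem isLetter_zero (hβ : 1 < β) {m : ℕ} (hm : 1 ≤ m) : IsLetter β m 0 := by
  refine ⟨isFull_zero hβ m, ?_⟩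
  rw [zero_add]
  have hβ0 : 0 < β := by linarith
  gcongr
  exact le_self_pow₀ hβ.le (by omega)

/-- The point of `[0, 1)` whose `β`-expansion is the concatenation of the expansions of the
letters `c 0, c 1, …`. -/
def point (β : ℝ) (m : ℕ) (c : ℕ → ℝ) : ℝ := ∑' r, c r * ((β ^ m)⁻¹) ^ r

section point

variable {m : ℕ} {c c' : ℕ → ℝ}

theorem inv_pow_lt_one (hβ : 1 < β) (hm : 1 ≤ m) : (β ^ m)⁻¹ < 1 :=
  inv_lt_one_of_one_lt₀ (one_lt_pow₀ hβ (by omega))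

theorem summable_point (hβ : 1 < β) (hm : 1 ≤ m) (hc : ∀ r, IsLetter β m (c r)) :
    Summable fun r => c r * ((β ^ m)⁻¹) ^ r := by
  have hβ0 : 0 < β := by linarith
  have hρ : 0 < (β ^ m)⁻¹ := by positivity
  refine Summable.of_nonneg_of_le (fun r => mul_nonneg (hc r).1.1 (by positivity)) (fun r => ?_)
    (summable_geometric_of_lt_one hρ.le (inv_pow_lt_one hβ hm))
  exact mul_le_of_le_one_left (by positivity) (by linarith [(hc r).1.add_le_one])

theorem point_eq_add (hβ : 1 < β) (hm : 1 ≤ m) (hc : ∀ r, IsLetter β m (c r)) :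
    point β m c = c 0 + point β m (fun r => c (r + 1)) / β ^ m := by
  rw [point, (summable_point hβ hm hc).tsum_eq_zero_add, point, div_eq_mul_inv, ← tsum_mul_right]
  simp only [pow_zero, mul_one, pow_succ, mul_assoc]

theorem point_nonneg (hβ : 1 < β) (hc : ∀ r, IsLetter β m (c r)) : 0 ≤ point β m c := by
  have hβ0 : 0 < β := by linarith
  exact tsum_nonneg fun r => mul_nonneg (hc r).1.1 (by positivity)

theorem point_le_inv (hβ : 1 < β) (hm : 1 ≤ m) (hc : ∀ r, IsLetter β m (c r)) :
    point β m c ≤ β⁻¹ := by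
  have hβ0 : 0 < β := by linarith
  have hρ : 0 < (β ^ m)⁻¹ := by positivity
  have hρ1 := inv_pow_lt_one hβ hm
  have hg := summable_geometric_of_lt_one hρ.le hρ1
  calc point β m c ≤ ∑' r : ℕ, (β⁻¹ - (β ^ m)⁻¹) * ((β ^ m)⁻¹) ^ r := by
        refine (summable_point hβ hm hc).tsum_le_tsum (fun r => ?_) (hg.mul_left _)
        gcongr
        linarith [(hc r).2]
    _ = (β⁻¹ - (β ^ m)⁻¹) * (1 - (β ^ m)⁻¹)⁻¹ := by
        rw [tsum_mul_left, tsum_geometric_of_lt_one hρ.le hρ1]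
    _ ≤ β⁻¹ := by
        rw [← div_eq_mul_inv, div_le_iff₀ (by linarith)]
        have : β⁻¹ * (β ^ m)⁻¹ ≤ 1 * (β ^ m)⁻¹ := by
          gcongr
          exact (inv_lt_one_of_one_lt₀ hβ).le
        linarith

theorem point_mem_Ico (hβ : 1 < β) (hm : 1 ≤ m) (hc : ∀ r, IsLetter β m (c r)) :
    point β m c ∈ Ico (0 : ℝ) 1 :=
  ⟨point_nonneg hβ hc, (point_le_inv hβ hm hc).trans_lt (inv_lt_one_of_one_lt₀ hβ)⟩

theorem iterate_mul_point (hβ : 1 < β) (hm : 1 ≤ m) (hc : ∀ r, IsLetter β m (c r)) (q : ℕ) :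
    (betaMap β)^[q * m] (point β m c) = point β m (fun r => c (r + q)) := by
  have hβ0 : 0 < β := by linarith
  induction q with
  | zero => simp
  | succ q ih =>
    rw [Nat.succ_mul, add_comm, Function.iterate_add_apply, ih,
      point_eq_add hβ hm (fun r => hc (r + q)),
      (hc (0 + q)).1.iterate_self_add_div hβ0 (point_mem_Ico hβ hm fun r => hc (r + 1 + q))]
    congr 1
    ext r
    congr 1
    ring

theorem floor_iterate_point (hβ : 1 < β) (hm : 1 ≤ m) (hc : ∀ r, IsLetter β m (c r)) (q : ℕ)
    {i : ℕ} (hi : i < m) :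
    ⌊β * (betaMap β)^[q * m + i] (point β m c)⌋ = ⌊β * (betaMap β)^[i] (c q)⌋ := by
  have hβ0 : 0 < β := by linarith
  have hmem := point_mem_Ico hβ hm fun r => hc (r + 1 + q)
  rw [add_comm, Function.iterate_add_apply, iterate_mul_point hβ hm hc,
    point_eq_add hβ hm (fun r => hc (r + q)), IsAffinePiece.floor_iterate_add hβ0 (hc (0 + q)).1
      (div_nonneg hmem.1 (by positivity)) _ hi, zero_add]
  rw [div_eq_mul_inv]
  exact mul_lt_of_lt_one_left (by positivity) hmem.2

/-- The endpoints of the two first letters are β^(-m) apart, and the remaining letters move each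
point by at most β⁻¹ β^(-m). This gap is what the leading digit 0 of the letters is for. -/
theorem abs_point_sub_point_of_ne (hβ : 1 < β) (hm : 1 ≤ m) (hc : ∀ r, IsLetter β m (c r))
    (hc' : ∀ r, IsLetter β m (c' r)) (hne : c 0 ≠ c' 0) :
    (1 - β⁻¹) * (β ^ m)⁻¹ ≤ |point β m c - point β m c'| := by
  have hβ0 : 0 < β := by linarith
  have hρ : 0 < (β ^ m)⁻¹ := by positivity
  rw [point_eq_add hβ hm hc, point_eq_add hβ hm hc']
  set p := point β m fun r => c (r + 1)
  set p' := point β m fun r => c' (r + 1)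
  have h1 : 0 ≤ p := point_nonneg hβ fun r => hc (r + 1)
  have h2 : p ≤ β⁻¹ := point_le_inv hβ hm fun r => hc (r + 1)
  have h3 : 0 ≤ p' := point_nonneg hβ fun r => hc' (r + 1)
  have h4 : p' ≤ β⁻¹ := point_le_inv hβ hm fun r => hc' (r + 1)
  have h5 := (hc 0).1.inv_le_abs_sub hβ0 (hc' 0).1 hne
  have h6 : |(p' - p) * (β ^ m)⁻¹| ≤ β⁻¹ * (β ^ m)⁻¹ := by
    rw [abs_mul, abs_of_pos hρ]
    gcongr
    rw [abs_le]
    constructor <;> linarith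
  have h7 := abs_sub_abs_le_abs_sub (c 0 - c' 0) ((p' - p) * (β ^ m)⁻¹)
  calc (1 - β⁻¹) * (β ^ m)⁻¹ ≤ |c 0 - c' 0| - |(p' - p) * (β ^ m)⁻¹| := by linarith
    _ ≤ _ := h7
    _ = _ := by congr 1; rw [div_eq_mul_inv, div_eq_mul_inv]; ring

theorem abs_point_sub_point_of_eq (hβ : 1 < β) (hm : 1 ≤ m) (q : ℕ) :
    ∀ {c c' : ℕ → ℝ}, (∀ r, IsLetter β m (c r)) → (∀ r, IsLetter β m (c' r)) →
    (∀ r < q, c r = c' r) →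
    |point β m c - point β m c'| = ((β ^ m)⁻¹) ^ q *
      |point β m (fun r => c (r + q)) - point β m (fun r => c' (r + q))| := by
  have hβ0 : 0 < β := by linarith
  have hρ : 0 < (β ^ m)⁻¹ := by positivity
  induction q with
  | zero => intros; simp
  | succ q ih =>
    intro c c' hc hc' h
    rw [point_eq_add hβ hm hc, point_eq_add hβ hm hc', h 0 (by omega), add_sub_add_left_eq_sub,
      ← sub_div, abs_div, abs_of_pos (show 0 < β ^ m by positivity),
      ih (fun r => hc (r + 1)) (fun r => hc' (r + 1)) fun r hr => h (r + 1) (by omega),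
      pow_succ, div_eq_mul_inv]
    simp only [add_assoc]
    ring

theorem abs_point_sub_point_ge (hβ : 1 < β) (hm : 1 ≤ m) (hc : ∀ r, IsLetter β m (c r))
    (hc' : ∀ r, IsLetter β m (c' r)) {q : ℕ} (hne : c q ≠ c' q) :
    (1 - β⁻¹) * ((β ^ m)⁻¹) ^ (q + 1) ≤ |point β m c - point β m c'| := by
  classical
  have hβ0 : 0 < β := by linarith
  have hρ : 0 < (β ^ m)⁻¹ := by positivity
  have hex : ∃ q, c q ≠ c' q := ⟨q, hne⟩
  set p := Nat.find hex with hp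
  have hpq : p ≤ q := Nat.find_min' hex hne
  have hpne : c p ≠ c' p := Nat.find_spec hex
  have h1 := abs_point_sub_point_of_ne hβ hm (fun r => hc (r + p)) (fun r => hc' (r + p))
    (by simpa using hpne)
  rw [abs_point_sub_point_of_eq hβ hm p hc hc' fun r hr => not_not.1 (Nat.find_min hex hr)]
  have hδ : 0 ≤ 1 - β⁻¹ := by linarith [inv_lt_one_of_one_lt₀ hβ]
  calc (1 - β⁻¹) * ((β ^ m)⁻¹) ^ (q + 1) ≤ (1 - β⁻¹) * ((β ^ m)⁻¹) ^ (p + 1) := by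
        refine mul_le_mul_of_nonneg_left ?_ hδ
        exact pow_le_pow_of_le_one hρ.le (inv_pow_lt_one hβ hm).le (by omega)
    _ = ((β ^ m)⁻¹) ^ p * ((1 - β⁻¹) * (β ^ m)⁻¹) := by ring
    _ ≤ _ := by gcongr

end point

/-- There are enough letters: at least `(βᵐ)^r` of them, apart from `0` and from one further
letter `t`. -/
theorem exists_letters (hβ : 1 < β) {r : ℝ} (hr : r < 1) :
    ∃ m N : ℕ, 1 ≤ m ∧ 2 ≤ N ∧ (β ^ m) ^ r ≤ N ∧ ∃ (e : Fin N → ℝ) (t : ℝ),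
      Function.Injective e ∧ (∀ i, IsLetter β m (e i)) ∧ (∀ i, e i ≠ 0) ∧
      IsLetter β m t ∧ t ≠ 0 ∧ ∀ i, e i ≠ t := by
  classical
  have hβ0 : 0 < β := by linarith
  have hγ : β ^ r < β := by
    conv_rhs => rw [← Real.rpow_one β]
    exact Real.rpow_lt_rpow_of_exponent_lt hβ hr
  have hγ0 : 0 < β ^ r := by positivity
  -- The expression is M (β^(rM) + 4) / β^(M-1). Once it is below 1, the full intervals of order M -
  -- 1 number at least β^(rM) + 4; dropping 0 and t still leaves at least two letters.
  have hlim : Tendsto (fun M : ℕ => β * (M * (β ^ r / β) ^ M) + 4 * β * (M * (β⁻¹) ^ M)) atTop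
      (𝓝 (β * 0 + 4 * β * 0)) := by
    refine Tendsto.add (Tendsto.const_mul _ ?_) (Tendsto.const_mul _ ?_)
    · exact tendsto_self_mul_const_pow_of_lt_one (by positivity) ((div_lt_one hβ0).2 hγ)
    · exact tendsto_self_mul_const_pow_of_lt_one (by positivity) (inv_lt_one_of_one_lt₀ hβ)
  simp only [mul_zero, add_zero] at hlim
  obtain ⟨M, hM1, hM⟩ := ((hlim.eventually_lt_const one_pos).and (eventually_ge_atTop 1)).exists
  obtain ⟨m, rfl⟩ : ∃ m, M = m + 1 := ⟨M - 1, by omega⟩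
  have hcount := pow_le_mul_ncard_isFull hβ m
  set F := (finite_setOf_isFull hβ0 m).toFinset with hF
  rw [ncard_eq_toFinset_card _ (finite_setOf_isFull hβ0 m), ← hF] at hcount
  have hbig : (β ^ r) ^ (m + 1) + 4 ≤ F.card := by
    rw [div_pow, inv_pow, pow_succ β m] at hM1
    have h1 : β * (((m + 1 : ℕ) : ℝ) * ((β ^ r) ^ (m + 1) / (β ^ m * β))) +
        4 * β * (((m + 1 : ℕ) : ℝ) * (β ^ m * β)⁻¹) =
        ((m + 1) * ((β ^ r) ^ (m + 1) + 4)) / β ^ m := by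
      push_cast
      field_simp
    rw [h1, div_lt_one (by positivity)] at hM1
    have h2 : ((m : ℝ) + 1) * ((β ^ r) ^ (m + 1) + 4) ≤ (m + 1) * F.card := hM1.le.trans hcount
    exact le_of_mul_le_mul_left h2 (by positivity)
  set G := F.erase 0 with hG
  have hGc : F.card - 1 ≤ G.card := Finset.pred_card_le_card_erase
  have hF4 : 4 ≤ F.card := by
    have : (4 : ℝ) ≤ F.card := by
      have : 0 < (β ^ r) ^ (m + 1) := by positivity
      linarith
    exact_mod_cast this
  obtain ⟨t, ht⟩ : G.Nonempty := Finset.card_pos.1 (by omega)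
  have hHc : G.card - 1 = (G.erase t).card := (Finset.card_erase_of_mem ht).symm
  have hmem : ∀ c ∈ G, IsLetter β (m + 1) (c / β) ∧ c / β ≠ 0 := by
    intro c hc
    obtain ⟨h1, h2⟩ := Finset.mem_erase.1 hc
    exact ⟨IsFull.isLetter_div hβ (by simpa [hF] using h2), div_ne_zero h1 hβ0.ne'⟩
  let e := (G.erase t).equivFin.symm
  refine ⟨m + 1, (G.erase t).card, by omega, by omega, ?_, fun i => (e i : ℝ) / β, t / β, ?_,
    fun i => (hmem _ (Finset.mem_of_mem_erase (e i).2)).1,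
    fun i => (hmem _ (Finset.mem_of_mem_erase (e i).2)).2, (hmem t ht).1, (hmem t ht).2, ?_⟩
  · have h1 : (F.card : ℝ) ≤ (G.erase t).card + 2 := by
      have : F.card ≤ (G.erase t).card + 2 := by omega
      exact_mod_cast this
    have h2 : (β ^ (m + 1)) ^ r = (β ^ r) ^ (m + 1) := by
      rw [← Real.rpow_natCast, ← Real.rpow_natCast, ← Real.rpow_mul hβ0.le,
        ← Real.rpow_mul hβ0.le, mul_comm]
    linarith
  · intro i j hij
    exact e.injective (Subtype.ext ((div_left_inj' hβ0.ne').1 hij))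
  · intro i hi
    exact Finset.ne_of_mem_erase (e i).2 ((div_left_inj' hβ0.ne').1 hi)

/-! ### The two points and their waiting times -/

/-- The block `q` belongs to one of the insertions; the `n`-th of them occupies the `n + 4` blocks
from `Q n` on. -/
def Inserted (Q : ℕ → ℕ) (q : ℕ) : Prop := ∃ n, Q n ≤ q ∧ q < Q n + n + 4

open Classical in
/-- The letters `ξ 0, ξ 1, …`, with `0, 0, η 0, …, η n, t` inserted at the blocks `Q n, Q n + 1, …`
for every `n`. -/
def layout (Q : ℕ → ℕ) (t : ℝ) (ξ η : ℕ → ℝ) (q : ℕ) : ℝ :=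
  if h : Inserted Q q then
    if q < Q h.choose + 2 then 0
    else if q < Q h.choose + h.choose + 3 then η (q - Q h.choose - 2) else t
  else ξ (Nat.count (fun p => ¬ Inserted Q p) q)

/-- The sequence `0, 0, η 0, η 1, …`. -/
def marked (η : ℕ → ℝ) (q : ℕ) : ℝ := if q < 2 then 0 else η (q - 2)

section layout

variable {Q : ℕ → ℕ} {t : ℝ} {ξ η : ℕ → ℝ}

theorem strictMono_of_add_le (hQ : ∀ n, Q n + n + 4 ≤ Q (n + 1)) : StrictMono Q :=
  strictMono_nat_of_lt_succ fun n => by have := hQ n; omega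

/-- The insertions are disjoint, so the index chosen in `layout` is determined. -/
theorem inserted_index_unique (hQ : ∀ n, Q n + n + 4 ≤ Q (n + 1)) {q n n' : ℕ}
    (h : Q n ≤ q ∧ q < Q n + n + 4) (h' : Q n' ≤ q ∧ q < Q n' + n' + 4) : n = n' := by
  have hmono := (strictMono_of_add_le hQ).monotone
  rcases lt_trichotomy n n' with hlt | rfl | hlt
  · have := hmono (show n + 1 ≤ n' from hlt)
    have := hQ n
    omega
  · rfl
  · have := hmono (show n' + 1 ≤ n from hlt)
    have := hQ n'
    omega

theorem layout_of_inserted (hQ : ∀ n, Q n + n + 4 ≤ Q (n + 1)) {n r : ℕ} (hr : r < n + 4) :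
    layout Q t ξ η (Q n + r) = if r < 2 then 0 else if r < n + 3 then η (r - 2) else t := by
  have h : Inserted Q (Q n + r) := ⟨n, by omega, by omega⟩
  have hn : h.choose = n :=
    inserted_index_unique hQ h.choose_spec ⟨by omega, by omega⟩
  rw [layout, dif_pos h, hn]
  simp only [add_lt_add_iff_left, add_assoc, Nat.add_sub_cancel_left]

theorem layout_of_not_inserted {q : ℕ} [DecidablePred fun p => ¬ Inserted Q p]
    (h : ¬ Inserted Q q) :
    layout Q t ξ η q = ξ (Nat.count (fun p => ¬ Inserted Q p) q) := by
  rw [layout, dif_neg h]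
  congr!

theorem layout_mem {P : ℝ → Prop} (h0 : P 0) (ht : P t) (hξ : ∀ r, P (ξ r)) (hη : ∀ r, P (η r))
    (q : ℕ) : P (layout Q t ξ η q) := by
  unfold layout
  split_ifs
  exacts [h0, hη _, ht, hξ _]

theorem marked_mem {P : ℝ → Prop} (h0 : P 0) (hη : ∀ r, P (η r)) (q : ℕ) : P (marked η q) := by
  unfold marked
  split_ifs
  exacts [h0, hη _]

theorem eq_of_layout_eq_zero (ht : t ≠ 0) (hξ : ∀ r, ξ r ≠ 0) (hη : ∀ r, η r ≠ 0) {q : ℕ}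
    (h : layout Q t ξ η q = 0) : ∃ n, q = Q n ∨ q = Q n + 1 := by
  unfold layout at h
  split_ifs at h with h1 h2 h3
  · have := h1.choose_spec
    exact ⟨h1.choose, by omega⟩
  exacts [absurd h (hη _), absurd h ht, absurd h (hξ _)]

variable {m : ℕ}

theorem floor_iterate_layout_eq_marked (hβ : 1 < β) (hm : 1 ≤ m)
    (hQ : ∀ n, Q n + n + 4 ≤ Q (n + 1)) (htl : IsLetter β m t) (hξ : ∀ r, IsLetter β m (ξ r))
    (hη : ∀ r, IsLetter β m (η r)) {n o : ℕ} (ho : o < (n + 3) * m) :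
    ⌊β * (betaMap β)^[Q n * m + o] (point β m (layout Q t ξ η))⌋ =
      ⌊β * (betaMap β)^[o] (point β m (marked η))⌋ := by
  have h0 := isLetter_zero hβ hm
  have hx : ∀ q, IsLetter β m (layout Q t ξ η q) := layout_mem h0 htl hξ hη
  have hy : ∀ q, IsLetter β m (marked η q) := marked_mem h0 hη
  have hdiv : o / m < n + 3 := Nat.div_lt_of_lt_mul (by rwa [mul_comm])
  have hmod : o % m < m := Nat.mod_lt _ (by omega)
  have h1 : (Q n + o / m) * m + o % m = Q n * m + o := by
    rw [add_mul, add_assoc, Nat.div_add_mod']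
  have h2 := floor_iterate_point hβ hm hx (Q n + o / m) hmod
  have h3 := floor_iterate_point hβ hm hy (o / m) hmod
  rw [h1, layout_of_inserted hQ (by omega), if_pos hdiv] at h2
  rw [Nat.div_add_mod', marked] at h3
  rw [h2, h3]

/-- The expansion of y starts with two zero letters. A match starting at an arbitrary digit of x
therefore contains a complete zero block within its first 2m digits, and such blocks exist only in
insertions. The position of the first nonzero digit then fixes the start, and the letter t ends the
match. -/
theorem eq_mul_of_iterate_mem_basicInterval (hβ : 1 < β) (hm : 1 ≤ m)
    (hQ : ∀ n, Q n + n + 4 ≤ Q (n + 1)) (htl : IsLetter β m t) (hξ : ∀ r, IsLetter β m (ξ r))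
    (hη : ∀ r, IsLetter β m (η r)) (ht0 : t ≠ 0) (hξ0 : ∀ r, ξ r ≠ 0) (hη0 : ∀ r, η r ≠ 0)
    (hηt : ∀ r, η r ≠ t) {k l : ℕ} (hl : 3 * m ≤ l)
    (hk : (betaMap β)^[k] (point β m (layout Q t ξ η)) ∈ basicInterval β l (point β m (marked η))) :
    ∃ n, k = Q n * m ∧ l < (n + 4) * m := by
  classical
  have hβ0 : 0 < β := by linarith
  have h0 := isLetter_zero hβ hm
  have hx : ∀ q, IsLetter β m (layout Q t ξ η q) := layout_mem h0 htl hξ hη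
  have hy : ∀ q, IsLetter β m (marked η q) := marked_mem h0 hη
  rw [iterate_mem_basicInterval_iff (point_mem_Ico hβ hm hx)] at hk
  have hX : ∀ q i, i < m → ⌊β * (betaMap β)^[q * m + i] (point β m (layout Q t ξ η))⌋ =
      ⌊β * (betaMap β)^[i] (layout Q t ξ η q)⌋ := fun q i hi => floor_iterate_point hβ hm hx q hi
  have hY : ∀ q i, i < m → ⌊β * (betaMap β)^[q * m + i] (point β m (marked η))⌋ =
      ⌊β * (betaMap β)^[i] (marked η q)⌋ := fun q i hi => floor_iterate_point hβ hm hy q hi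
  have hXY : ∀ n o, o < (n + 3) * m →
      ⌊β * (betaMap β)^[Q n * m + o] (point β m (layout Q t ξ η))⌋ =
      ⌊β * (betaMap β)^[o] (point β m (marked η))⌋ := fun n o ho =>
    floor_iterate_layout_eq_marked hβ hm hQ htl hξ hη ho
  generalize hXd : (fun p => ⌊β * (betaMap β)^[p] (point β m (layout Q t ξ η))⌋) = X
  generalize hYd : (fun p => ⌊β * (betaMap β)^[p] (point β m (marked η))⌋) = Y
  have hX' : ∀ p, ⌊β * (betaMap β)^[p] (point β m (layout Q t ξ η))⌋ = X p := fun p => by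
    rw [← hXd]
  have hY' : ∀ p, ⌊β * (betaMap β)^[p] (point β m (marked η))⌋ = Y p := fun p => by
    rw [← hYd]
  simp only [hX', hY'] at hk hX hY hXY
  -- the first nonzero digit of `y`
  have hex := (hη 0).1.exists_floor_ne_zero hβ (hη0 0)
  obtain ⟨hi0m, hi0⟩ := Nat.find_spec hex
  have hmin : ∀ i < Nat.find hex, ⌊β * (betaMap β)^[i] (η 0)⌋ = 0 := fun i hi => by
    by_contra hne
    exact Nat.find_min hex hi ⟨by omega, hne⟩
  generalize Nat.find hex = i₀ at hi0m hi0 hmin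
  have hYtwo : ∀ i, i < m → Y (2 * m + i) = ⌊β * (betaMap β)^[i] (η 0)⌋ := fun i hi => by
    rw [hY 2 i hi]; simp [marked]
  have hYne : Y (2 * m + i₀) ≠ 0 := by rwa [hYtwo i₀ hi0m]
  have hYzero : ∀ o < 2 * m + i₀, Y o = 0 := by
    intro o ho
    rcases Nat.lt_or_ge o (2 * m) with h | h
    · have h1 := hY (o / m) (o % m) (Nat.mod_lt _ (by omega))
      have h2 : o / m < 2 := Nat.div_lt_of_lt_mul (by omega)
      rw [Nat.div_add_mod', marked, if_pos h2, iterate_betaMap_zero] at h1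
      simpa using h1
    · obtain ⟨i, rfl⟩ := Nat.exists_eq_add_of_le h
      rw [hYtwo i (by omega), hmin i (by omega)]
  -- the first complete block of `x` after `k`
  obtain ⟨q, j, hkj, hjm⟩ : ∃ q j, k + j = q * m ∧ j < m := by
    have hmod : k % m < m := Nat.mod_lt _ (by omega)
    have hdm := Nat.div_add_mod' k m
    rcases Nat.eq_zero_or_pos (k % m) with h | h
    · exact ⟨k / m, 0, by omega, by omega⟩
    · exact ⟨k / m + 1, m - k % m, by rw [Nat.succ_mul]; omega, by omega⟩
  have hq0 : layout Q t ξ η q = 0 := by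
    by_contra hne
    obtain ⟨i, hi, hine⟩ := (hx q).1.exists_floor_ne_zero hβ hne
    rw [← hX q i hi, ← hkj, add_assoc, hk _ (by omega)] at hine
    exact hine (hYzero _ (by omega))
  obtain ⟨n, hn⟩ := eq_of_layout_eq_zero ht0 hξ0 hη0 hq0
  have h3m : 3 * m ≤ (n + 3) * m := Nat.mul_le_mul_right _ (by omega)
  have hkn : k = Q n * m := by
    rcases hn with rfl | rfl
    -- Starting j > 0 digits before the insertion, x would still show a 0 where y has its first
    -- nonzero digit.
    · by_contra hne
      have h1 := hk (2 * m + i₀) (by omega)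
      rw [show k + (2 * m + i₀) = Q n * m + (2 * m + i₀ - j) by omega, hXY n _ (by omega),
        hYzero _ (by omega)] at h1
      exact hYne h1.symm
    -- Starting m - j > 0 digits inside the insertion, x would show its nonzero digit where y still
    -- has a 0.
    · rw [Nat.succ_mul] at hkj
      have h1 := hk (2 * m + i₀ - (m - j)) (by omega)
      rw [show k + (2 * m + i₀ - (m - j)) = Q n * m + (2 * m + i₀) by omega, hXY n _ (by omega),
        hYzero (2 * m + i₀ - (m - j)) (by omega)] at h1
      exact absurd h1 hYne
  refine ⟨n, hkn, ?_⟩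
  by_contra! hcon
  -- A longer match would cover block n + 3 of the insertion, where x carries t and y carries η (n +
  -- 1).
  refine hηt (n + 1) ((hη (n + 1)).1.eq_of_floor_eq hβ0 htl.1 fun i hi => ?_)
  have h1 := hk ((n + 3) * m + i) (by rw [Nat.succ_mul] at hcon; omega)
  rw [hkn, ← add_assoc, ← add_mul, hX _ i hi, hY _ i hi, layout_of_inserted hQ (by omega), marked,
    if_neg (by omega), if_neg (by omega), if_neg (by omega)] at h1
  exact h1.symm

theorem waitingTime_le (hβ : 1 < β) (hm : 1 ≤ m)
    (hQ : ∀ n, Q n + n + 4 ≤ Q (n + 1)) (hQ0 : 1 ≤ Q 0) (htl : IsLetter β m t)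
    (hξ : ∀ r, IsLetter β m (ξ r)) (hη : ∀ r, IsLetter β m (η r)) {n l : ℕ}
    (hl : l ≤ (n + 3) * m) :
    waitingTime β l (point β m (layout Q t ξ η)) (point β m (marked η)) ≤ (Q n * m : ℕ) := by
  refine iInf₂_le (Q n * m) ⟨?_, ?_⟩
  · exact Nat.mul_pos (hQ0.trans ((strictMono_of_add_le hQ).monotone (Nat.zero_le n))) hm
  · rw [iterate_mem_basicInterval_iff
      (point_mem_Ico hβ hm (layout_mem (isLetter_zero hβ hm) htl hξ hη))]
    exact fun i hi => floor_iterate_layout_eq_marked hβ hm hQ htl hξ hη (hi.trans_le hl)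

theorem le_waitingTime (hβ : 1 < β) (hm : 1 ≤ m)
    (hQ : ∀ n, Q n + n + 4 ≤ Q (n + 1)) (htl : IsLetter β m t) (hξ : ∀ r, IsLetter β m (ξ r))
    (hη : ∀ r, IsLetter β m (η r)) (ht0 : t ≠ 0) (hξ0 : ∀ r, ξ r ≠ 0) (hη0 : ∀ r, η r ≠ 0)
    (hηt : ∀ r, η r ≠ t) {n l : ℕ} (hl : (n + 3) * m ≤ l) :
    (Q n * m : ℕ) ≤
      waitingTime β l (point β m (layout Q t ξ η)) (point β m (marked η)) := by
  refine le_iInf₂ fun k hk => ?_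
  have h3m : 3 * m ≤ (n + 3) * m := Nat.mul_le_mul_right _ (by omega)
  obtain ⟨n', rfl, hn'⟩ := eq_mul_of_iterate_mem_basicInterval hβ hm hQ htl hξ hη ht0 hξ0 hη0 hηt
    (h3m.trans hl) hk.2
  have : n + 3 < n' + 4 := lt_of_mul_lt_mul_right (hl.trans_lt hn') (Nat.zero_le m)
  exact_mod_cast Nat.mul_le_mul_right m ((strictMono_of_add_le hQ).monotone (show n ≤ n' by omega))

end layout

/-! ### A growth function with prescribed lower and upper rates -/

/-- A monotone sequence of reals that converges to the extended real `x ≥ 0`. -/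
def approx (x : EReal) (n : ℕ) : ℝ := if x = ⊤ then n else x.toReal

theorem approx_nonneg {x : EReal} (hx : 0 ≤ x) (n : ℕ) : 0 ≤ approx x n := by
  unfold approx
  split_ifs
  · positivity
  · exact EReal.toReal_nonneg hx

theorem approx_monotone (x : EReal) : Monotone (approx x) := by
  intro n n' h
  unfold approx
  split_ifs
  · exact_mod_cast h
  · rfl

theorem approx_le (x : EReal) (n : ℕ) : approx x n ≤ n + |x.toReal| := by
  unfold approx
  split_ifs
  · linarith [abs_nonneg x.toReal]
  · have : (0 : ℝ) ≤ n := n.cast_nonneg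
    linarith [le_abs_self x.toReal]

theorem tendsto_approx {x : EReal} (hx : 0 ≤ x) :
    Tendsto (fun n => (approx x n : EReal)) atTop (𝓝 x) := by
  by_cases h : x = ⊤
  · simp only [approx, h, if_true]
    exact EReal.tendsto_coe_nhds_top_iff.2 tendsto_natCast_atTop_atTop
  · have hb : x ≠ ⊥ := fun hb => by simp [hb] at hx
    simp only [approx, h, if_false, EReal.coe_toReal h hb]
    exact tendsto_const_nhds

theorem tendsto_coe_add_of_tendsto_zero {ι : Type*} {l : Filter ι} {f g : ι → ℝ} {x : EReal}
    (hf : Tendsto (fun i => (f i : EReal)) l (𝓝 x)) (hg : Tendsto g l (𝓝 0)) :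
    Tendsto (fun i => ((f i + g i : ℝ) : EReal)) l (𝓝 x) := by
  have h1 := (EReal.continuousAt_add (p := (x, (0 : EReal))) (by simp) (by simp)).tendsto.comp
    (hf.prodMk_nhds (EReal.tendsto_coe.2 hg))
  simpa [Function.comp_def] using h1

theorem tendsto_coe_mul_of_tendsto_one {ι : Type*} {l : Filter ι} {f g : ι → ℝ} {x : EReal}
    (hf : Tendsto (fun i => (f i : EReal)) l (𝓝 x)) (hg : Tendsto g l (𝓝 1)) :
    Tendsto (fun i => ((f i * g i : ℝ) : EReal)) l (𝓝 x) := by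
  have h1 := (EReal.continuousAt_mul (p := (x, (1 : EReal))) (Or.inr (EReal.coe_ne_bot 1))
    (Or.inr (EReal.coe_ne_top 1)) (by simp) (by simp)).tendsto.comp (hf.prodMk_nhds (EReal.tendsto_coe.2 hg))
  simpa [Function.comp_def] using h1

theorem log_two_pow_sub_one (k : ℕ) : Nat.log 2 (2 ^ (k + 1) - 1) = k := by
  have h1 : 1 ≤ 2 ^ k := Nat.one_le_two_pow
  refine Nat.log_eq_of_pow_le_of_lt_pow ?_ ?_ <;> rw [pow_succ] <;> omega

/-- A monotone function with prescribed lower and upper linear growth rates. -/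
theorem exists_monotone_growth {a b : EReal} (ha : 0 ≤ a) (hab : a ≤ b) :
    ∃ (h f g : ℕ → ℝ) (u v : ℕ → ℕ), Monotone h ∧ (∀ n, 0 ≤ h n) ∧
      Tendsto (fun n => (f n : EReal)) atTop (𝓝 a) ∧
      Tendsto (fun n => (g n : EReal)) atTop (𝓝 b) ∧
      (∀ n, f n * n ≤ h n) ∧ (∀ n, 2 ≤ n → h n ≤ g n * n) ∧
      Tendsto u atTop atTop ∧ Tendsto v atTop atTop ∧
      Tendsto (fun k => ((h (u k) / u k : ℝ) : EReal)) atTop (𝓝 a) ∧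
      Tendsto (fun k => ((h (v k) / v k : ℝ) : EReal)) atTop (𝓝 b) := by
  have hb : 0 ≤ b := ha.trans hab
  set f := approx a with hf
  -- The maximum keeps f ≤ g when b = ⊤, where the approximations of b start below a finite a.
  set g : ℕ → ℝ := fun n => max (approx a n) (approx b n) with hg
  have hf0 : ∀ n, 0 ≤ f n := approx_nonneg ha
  have hfm : Monotone f := approx_monotone a
  have hg0 : ∀ n, 0 ≤ g n := fun n => (hf0 n).trans (le_max_left _ _)
  have hgm : Monotone g := (approx_monotone a).max (approx_monotone b)
  have hgt : Tendsto (fun n => (g n : EReal)) atTop (𝓝 b) := by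
    have := (tendsto_approx ha).max (tendsto_approx hb)
    rw [max_eq_right hab] at this
    simpa only [hg, EReal.coe_strictMono.monotone.map_max] using this
  have hft : Tendsto (fun n => (f n : EReal)) atTop (𝓝 a) := tendsto_approx ha
  -- For n ≥ 2 this is the k with 2^(2^k) ≤ n < 2^(2^(k+1)). At the left end of each such range `h`
  -- reaches slope g k; its second term then stays constant while n is almost squared, so at the
  -- right end only the slope f is left.
  set κ : ℕ → ℕ := fun n => Nat.log 2 (Nat.log 2 n) with hκ
  have hκm : Monotone κ := fun n n' h => Nat.log_mono_right (Nat.log_mono_right h)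
  set h : ℕ → ℝ := fun n => max (f n * n) (g (κ n) * 2 ^ 2 ^ κ n) with hh
  have hle : ∀ n, 2 ≤ n → h n ≤ g n * n := by
    intro n hn
    refine max_le ?_ ?_
    · exact mul_le_mul_of_nonneg_right (le_max_left _ _) n.cast_nonneg
    · have h1 : Nat.log 2 n ≠ 0 := (Nat.log_pos (by norm_num) hn).ne'
      have h2 : 2 ^ κ n ≤ Nat.log 2 n := Nat.pow_log_le_self 2 h1
      have h3 : 2 ^ Nat.log 2 n ≤ n := Nat.pow_log_le_self 2 (by omega)
      have h4 : 2 ^ 2 ^ κ n ≤ n := (Nat.pow_le_pow_right (by norm_num) h2).trans h3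
      have h5 : (2 : ℝ) ^ 2 ^ κ n ≤ n := by exact_mod_cast h4
      have h6 : κ n ≤ n := (Nat.log_le_self _ _).trans (Nat.log_le_self _ _)
      exact mul_le_mul (hgm h6) h5 (by positivity) (hg0 _)
  have hk2 : ∀ k : ℕ, k < 2 ^ 2 ^ k := fun k =>
    Nat.lt_two_pow_self.trans (Nat.pow_lt_pow_right (by norm_num) Nat.lt_two_pow_self)
  have hvt : Tendsto (fun k : ℕ => 2 ^ 2 ^ k) atTop atTop :=
    tendsto_atTop_mono (fun k => (hk2 k).le) tendsto_id
  have hsq : ∀ k : ℕ, (2 : ℕ) ^ 2 ^ (k + 1) = 2 ^ 2 ^ k * 2 ^ 2 ^ k := fun k => by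
    rw [← pow_add]; congr 1; ring
  have hut' : ∀ k : ℕ, 2 ^ 2 ^ k * 2 ^ 2 ^ k ≤ 2 * (2 ^ 2 ^ (k + 1) - 1) := fun k => by
    have h1 := hsq k
    have h2 : 1 * 1 < 2 ^ 2 ^ k * 2 ^ 2 ^ k := by
      have : 1 < 2 ^ 2 ^ k := Nat.one_lt_two_pow (by positivity)
      exact Nat.mul_lt_mul'' this this
    omega
  have hut : Tendsto (fun k : ℕ => 2 ^ 2 ^ (k + 1) - 1) atTop atTop := by
    refine tendsto_atTop_mono (fun k => ?_) tendsto_id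
    have := hk2 (k + 1)
    simp only [id]
    omega
  refine ⟨h, f, g, fun k => 2 ^ 2 ^ (k + 1) - 1, fun k => 2 ^ 2 ^ k, ?_, ?_, hft, hgt,
    fun n => le_max_left _ _, hle, hut, hvt, ?_, ?_⟩
  · intro n n' hnn
    have h1 := hκm hnn
    refine max_le_max ?_ ?_
    · exact mul_le_mul (hfm hnn) (by exact_mod_cast hnn) (by positivity) (hf0 _)
    · refine mul_le_mul (hgm h1) ?_ (by positivity) (hg0 _)
      exact pow_le_pow_right₀ (by norm_num) (Nat.pow_le_pow_right (by norm_num) h1)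
  · exact fun n => (mul_nonneg (hf0 n) n.cast_nonneg).trans (le_max_left _ _)
  -- Even for infinite rates g grows at most linearly, so the leftover slope at the right end tends
  -- to 0.
  · have hτ : Tendsto (fun k : ℕ => 2 * (g k / 2 ^ 2 ^ k)) atTop (𝓝 0) := by
      have h1 : Tendsto (fun k : ℕ => 2 * ((k : ℝ) * (1 / 2) ^ k +
          (|a.toReal| + |b.toReal|) * (1 / 2) ^ k)) atTop (𝓝 (2 * (0 +
            (|a.toReal| + |b.toReal|) * 0))) := by
        refine Tendsto.const_mul _ (Tendsto.add ?_ (Tendsto.const_mul _ ?_))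
        · exact tendsto_self_mul_const_pow_of_lt_one (by norm_num) (by norm_num)
        · exact tendsto_pow_atTop_nhds_zero_of_lt_one (by norm_num) (by norm_num)
      simp only [mul_zero, add_zero] at h1
      refine squeeze_zero (fun k => ?_) (fun k => ?_) h1
      · have := hg0 k
        positivity
      · have h2 : g k ≤ k + (|a.toReal| + |b.toReal|) := by
          refine max_le ?_ ?_
          · linarith [approx_le a k, abs_nonneg b.toReal]
          · linarith [approx_le b k, abs_nonneg a.toReal]
        rw [← add_mul, one_div, inv_pow, ← div_eq_mul_inv]
        have h3 : (2 : ℝ) ^ k ≤ 2 ^ 2 ^ k :=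
          pow_le_pow_right₀ (by norm_num) Nat.lt_two_pow_self.le
        have := hg0 k
        gcongr
    have hfu := tendsto_coe_add_of_tendsto_zero (hft.comp hut) hτ
    refine tendsto_of_tendsto_of_tendsto_of_le_of_le (hft.comp hut) hfu (fun k => ?_) (fun k => ?_)
    all_goals
      have hκu : κ (2 ^ 2 ^ (k + 1) - 1) = k := by
        have h1 : 2 ^ (k + 1) = (2 ^ (k + 1) - 1) + 1 := by
          have : 1 ≤ 2 ^ (k + 1) := Nat.one_le_two_pow
          omega
        simp only [hκ]
        rw [h1, log_two_pow_sub_one, log_two_pow_sub_one]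
      have h1 : (2 ^ 2 ^ k * 2 ^ 2 ^ k : ℝ) ≤ 2 * ((2 ^ 2 ^ (k + 1) - 1 : ℕ) : ℝ) := by
        exact_mod_cast hut' k
      simp only [Function.comp_apply, hh, hκu]
      generalize 2 ^ 2 ^ (k + 1) - 1 = n at *
      have hpos : (0 : ℝ) < 2 ^ 2 ^ k := by positivity
      have hn : (0 : ℝ) < n := by nlinarith
      refine EReal.coe_le_coe_iff.2 ?_
    · rw [le_div_iff₀ hn]
      exact le_max_left _ _
    · rw [div_le_iff₀ hn]
      have h2 : g k * 2 ^ 2 ^ k ≤ 2 * (g k / 2 ^ 2 ^ k) * n := by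
        have h3 : 2 * (g k / 2 ^ 2 ^ k) * n = g k * (2 * n / 2 ^ 2 ^ k) := by ring
        rw [h3]
        refine mul_le_mul_of_nonneg_left ?_ (hg0 k)
        rw [le_div_iff₀ hpos]
        linarith
      have h4 := mul_nonneg (hf0 n) hn.le
      have h5 : 0 ≤ g k * 2 ^ 2 ^ k := mul_nonneg (hg0 k) hpos.le
      refine max_le ?_ ?_ <;> linarith
  · refine tendsto_of_tendsto_of_tendsto_of_le_of_le hgt (hgt.comp hvt) (fun k => ?_) (fun k => ?_)
    · have hκv : κ (2 ^ 2 ^ k) = k := by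
        simp only [hκ, Nat.log_pow one_lt_two]
      refine EReal.coe_le_coe_iff.2 ?_
      rw [le_div_iff₀ (by positivity)]
      refine le_trans ?_ (le_max_right _ _)
      rw [hκv]
      push_cast
      exact le_rfl
    · refine EReal.coe_le_coe_iff.2 ?_
      rw [div_le_iff₀ (by positivity)]
      refine hle _ ?_
      calc 2 = 2 ^ 1 := rfl
        _ ≤ 2 ^ 2 ^ k := Nat.pow_le_pow_right (by norm_num) Nat.one_le_two_pow

theorem liminf_le_of_tendsto_comp {w z : ℕ → EReal} {u : ℕ → ℕ} {a : EReal}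
    (hu : Tendsto u atTop atTop) (hz : Tendsto z atTop (𝓝 a)) (hle : ∀ᶠ k in atTop, w (u k) ≤ z k) :
    liminf w atTop ≤ a := by
  calc liminf w atTop ≤ liminf w (map u atTop) := liminf_le_liminf_of_le hu
    _ = liminf (w ∘ u) atTop := rfl
    _ ≤ liminf z atTop := liminf_le_liminf hle
    _ = a := hz.liminf_eq

theorem le_limsup_of_tendsto_comp {w z : ℕ → EReal} {u : ℕ → ℕ} {a : EReal}
    (hu : Tendsto u atTop atTop) (hz : Tendsto z atTop (𝓝 a)) (hle : ∀ᶠ k in atTop, z k ≤ w (u k)) :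
    a ≤ limsup w atTop := by
  calc a = limsup z atTop := hz.limsup_eq.symm
    _ ≤ limsup (w ∘ u) atTop := limsup_le_limsup hle
    _ = limsup w (map u atTop) := rfl
    _ ≤ limsup w atTop := limsup_le_limsup_of_le hu

theorem tendsto_cast_div_cast_add (d : ℕ) :
    Tendsto (fun n : ℕ => (n : ℝ) / ((n + d : ℕ) : ℝ)) atTop (𝓝 1) := by
  have h := (tendsto_const_div_atTop_nhds_zero_nat (d : ℝ)).const_add 1
  rw [add_zero] at h
  have h2 := h.inv₀ one_ne_zero
  rw [inv_one] at h2
  refine h2.congr' ?_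
  filter_upwards [eventually_gt_atTop 0] with n hn
  have : (0 : ℝ) < n := by exact_mod_cast hn
  push_cast
  field_simp

/-- A perturbation of `n ↦ h n / n` has the same lower and upper limits. -/
theorem exists_growth_with_stable_limits {a b : EReal} (ha : 0 ≤ a) (hab : a ≤ b) :
    ∃ h : ℕ → ℝ, Monotone h ∧ (∀ n, 0 ≤ h n) ∧ ∀ (d : ℕ) (τ : ℕ → ℝ) (w : ℕ → EReal),
      Tendsto τ atTop (𝓝 0) →
      (∀ᶠ n in atTop, ((h n / ((n + d : ℕ) : ℝ) : ℝ) : EReal) ≤ w (n + d)) →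
      (∀ᶠ n in atTop, w n ≤ ((h n / n + τ n : ℝ) : EReal)) →
      liminf w atTop = a ∧ limsup w atTop = b := by
  obtain ⟨h, f, g, u, v, hm, h0, hf, hg, hfh, hhg, hu, hv, hhu, hhv⟩ := exists_monotone_growth ha hab
  refine ⟨h, hm, h0, fun d τ w hτ hw1 hw2 => ⟨le_antisymm ?_ ?_, le_antisymm ?_ ?_⟩⟩
  · exact liminf_le_of_tendsto_comp hu (tendsto_coe_add_of_tendsto_zero hhu (hτ.comp hu)) (hu.eventually hw2)
  · rw [← liminf_nat_add w d]
    rw [← (tendsto_coe_mul_of_tendsto_one hf (tendsto_cast_div_cast_add d)).liminf_eq]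
    refine liminf_le_liminf ?_
    filter_upwards [hw1] with n hn
    refine le_trans (EReal.coe_le_coe_iff.2 ?_) hn
    rw [← mul_div_assoc]
    gcongr
    exact hfh n
  · rw [← (tendsto_coe_add_of_tendsto_zero hg hτ).limsup_eq]
    refine limsup_le_limsup ?_
    filter_upwards [hw2, eventually_ge_atTop 2] with n hn hn2
    refine hn.trans (EReal.coe_le_coe_iff.2 ?_)
    gcongr
    rw [div_le_iff₀ (by exact_mod_cast (by omega : 0 < n))]
    exact hhg n hn2
  · refine le_limsup_of_tendsto_comp (tendsto_add_atTop_nat d |>.comp hv)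
      (tendsto_coe_mul_of_tendsto_one hhv ((tendsto_cast_div_cast_add d).comp hv)) ?_
    filter_upwards [hv.eventually hw1, hv.eventually_gt_atTop 0] with k hk hk0
    refine le_trans (EReal.coe_le_coe_iff.2 (le_of_eq ?_)) hk
    have : (0 : ℝ) < v k := by exact_mod_cast hk0
    simp only [Function.comp_apply]
    field_simp

/-! ### Positions of the insertions and waiting rates -/

/-- The blocks at which the insertions start. -/
def insertionStart (h : ℕ → ℝ) (m n : ℕ) : ℕ := (n + 4) ^ 3 * ⌈Real.exp (h (m * n))⌉₊

section insertionStart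

variable {h : ℕ → ℝ} {m : ℕ}

/-- The first n insertions fill about n² blocks, so cubic growth makes them sparse; in the logarithm
of the waiting time it costs only O(log n). -/
theorem pow_le_insertionStart (n : ℕ) : (n + 4) ^ 3 ≤ insertionStart h m n :=
  Nat.le_mul_of_pos_right _ (Nat.ceil_pos.2 (Real.exp_pos _))

theorem insertionStart_add_le (hm : Monotone h) (n : ℕ) :
    insertionStart h m n + n + 4 ≤ insertionStart h m (n + 1) := by
  unfold insertionStart
  have h1 : ⌈Real.exp (h (m * n))⌉₊ ≤ ⌈Real.exp (h (m * (n + 1)))⌉₊ :=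
    Nat.ceil_mono (Real.exp_le_exp.2 (hm (Nat.mul_le_mul_left _ (by omega))))
  have h2 : 1 ≤ ⌈Real.exp (h (m * n))⌉₊ := Nat.ceil_pos.2 (Real.exp_pos _)
  calc (n + 4) ^ 3 * ⌈Real.exp (h (m * n))⌉₊ + n + 4
      ≤ (n + 1 + 4) ^ 3 * ⌈Real.exp (h (m * n))⌉₊ := by nlinarith [sq_nonneg n]
    _ ≤ _ := Nat.mul_le_mul_left _ h1

theorem le_log_insertionStart_mul (hm : 1 ≤ m) (n : ℕ) :
    h (m * n) ≤ Real.log ((insertionStart h m n * m : ℕ) : ℝ) := by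
  rw [Real.le_log_iff_exp_le]
  · refine (Nat.le_ceil _).trans ?_
    unfold insertionStart
    have : ⌈Real.exp (h (m * n))⌉₊ ≤ (n + 4) ^ 3 * ⌈Real.exp (h (m * n))⌉₊ * m := by
      rw [mul_right_comm]
      exact Nat.le_mul_of_pos_left _ (by positivity)
    exact_mod_cast this
  · have := pow_le_insertionStart (h := h) (m := m) n
    have : 0 < (n + 4) ^ 3 := by positivity
    have : 0 < insertionStart h m n * m := Nat.mul_pos (by omega) hm
    exact_mod_cast this

theorem log_insertionStart_mul_le (h0 : ∀ n, 0 ≤ h n) (hm : 1 ≤ m) (n : ℕ) :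
    Real.log ((insertionStart h m n * m : ℕ) : ℝ) ≤
      h (m * n) + (3 * Real.log (n + 4) + Real.log (2 * m)) := by
  have hm' : (0 : ℝ) < m := by exact_mod_cast hm
  have hn : (0 : ℝ) < n + 4 := by positivity
  have h1 : (⌈Real.exp (h (m * n))⌉₊ : ℝ) ≤ 2 * Real.exp (h (m * n)) := by
    have := (Nat.ceil_lt_add_one (Real.exp_pos (h (m * n))).le).le
    have := Real.one_le_exp (h0 (m * n))
    linarith
  have h2 : (0 : ℝ) < ⌈Real.exp (h (m * n))⌉₊ := by
    exact_mod_cast Nat.ceil_pos.2 (Real.exp_pos _)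
  have h3 : ((insertionStart h m n * m : ℕ) : ℝ) ≤
      Real.exp (h (m * n)) * ((n + 4) ^ 3 * (2 * m)) := by
    unfold insertionStart
    push_cast
    have : ((n : ℝ) + 4) ^ 3 * ⌈Real.exp (h (m * n))⌉₊ * m ≤
        (n + 4) ^ 3 * (2 * Real.exp (h (m * n))) * m := by gcongr
    linarith
  refine (Real.log_le_log ?_ h3).trans (le_of_eq ?_)
  · unfold insertionStart
    push_cast
    positivity
  · rw [Real.log_mul (Real.exp_pos _).ne' (by positivity), Real.log_exp,
      Real.log_mul (by positivity) (by positivity), Real.log_pow]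
    push_cast
    rfl

end insertionStart

theorem ennreal_log_natCast {k : ℕ} (hk : 0 < k) :
    ENNReal.log (k : ENNReal) = (Real.log k : EReal) := by
  rw [← ENNReal.ofReal_natCast, ENNReal.log_ofReal_of_pos (by exact_mod_cast hk)]

theorem coe_le_waitingRate {x y s : ℝ} {n k : ℕ} (hk : 0 < k) (hs : s ≤ Real.log k)
    (h : (k : ℕ∞) ≤ waitingTime β n x y) : ((s / n : ℝ) : EReal) ≤ waitingRate β x y n := by
  have h1 : (k : ENNReal) ≤ (waitingTime β n x y : ENNReal) := by
    have := ENat.toENNReal_le.2 h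
    simpa using this
  have h2 := ENNReal.log_le_log h1
  rw [ennreal_log_natCast hk] at h2
  rw [waitingRate, EReal.coe_div]
  exact EReal.div_le_div_right_of_nonneg (by positivity) ((EReal.coe_le_coe_iff.2 hs).trans h2)

theorem waitingRate_le_coe {x y s : ℝ} {n k : ℕ} (hk : 0 < k) (hs : Real.log k ≤ s)
    (h : waitingTime β n x y ≤ (k : ℕ∞)) : waitingRate β x y n ≤ ((s / n : ℝ) : EReal) := by
  have h1 : (waitingTime β n x y : ENNReal) ≤ (k : ENNReal) := by
    have := ENat.toENNReal_le.2 h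
    simpa using this
  have h2 := ENNReal.log_le_log h1
  rw [ennreal_log_natCast hk] at h2
  rw [waitingRate, EReal.coe_div]
  exact EReal.div_le_div_right_of_nonneg (by positivity) (h2.trans (EReal.coe_le_coe_iff.2 hs))

theorem tendsto_log_add_div (m : ℕ) :
    Tendsto (fun l : ℕ => (3 * Real.log ((l : ℝ) + 4) + Real.log (2 * m)) / (l : ℝ)) atTop
      (𝓝 0) := by
  have h1 : Tendsto (fun x : ℝ => Real.log x / (1 * x + (-4))) atTop (𝓝 0) := by
    simpa using Real.tendsto_pow_log_div_mul_add_atTop 1 (-4) 1 one_ne_zero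
  have h2 : Tendsto (fun l : ℕ => (l : ℝ) + 4) atTop atTop :=
    tendsto_atTop_add_const_right _ _ tendsto_natCast_atTop_atTop
  have h3 := ((h1.comp h2).const_mul 3).add
    (tendsto_const_div_atTop_nhds_zero_nat (Real.log (2 * m)))
  rw [mul_zero, add_zero] at h3
  refine h3.congr fun l => ?_
  simp only [Function.comp_apply]
  rw [add_div, mul_div_assoc]
  congr 4
  ring

/-- Placing the insertions suitably realizes any pair of indicators. -/
theorem exists_insertions {a b : EReal} (hβ : 1 < β) (ha : 0 ≤ a) (hab : a ≤ b) {m : ℕ}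
    (hm : 1 ≤ m) : ∃ Q : ℕ → ℕ, (∀ n, Q n + n + 4 ≤ Q (n + 1)) ∧ (∀ n, (n + 4) ^ 3 ≤ Q n) ∧
      ∀ (t : ℝ) (ξ η : ℕ → ℝ), IsLetter β m t → (∀ r, IsLetter β m (ξ r)) →
        (∀ r, IsLetter β m (η r)) → t ≠ 0 → (∀ r, ξ r ≠ 0) → (∀ r, η r ≠ 0) → (∀ r, η r ≠ t) →
        (point β m (layout Q t ξ η), point β m (marked η)) ∈ waitingSet β a b := by
  obtain ⟨h, hmono, h0, hlim⟩ := exists_growth_with_stable_limits ha hab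
  have hQ : ∀ n, insertionStart h m n + n + 4 ≤ insertionStart h m (n + 1) :=
    insertionStart_add_le hmono
  have hQ1 : ∀ n, (n + 4) ^ 3 ≤ insertionStart h m n := pow_le_insertionStart
  have hQpos : ∀ n, 0 < insertionStart h m n * m := fun n => by
    have : 0 < (n + 4) ^ 3 := by positivity
    exact Nat.mul_pos (by have := hQ1 n; omega) hm
  refine ⟨insertionStart h m, hQ, hQ1, fun t ξ η htl hξ hη ht0 hξ0 hη0 hηt => ?_⟩
  refine ⟨point_mem_Ico hβ hm (layout_mem (isLetter_zero hβ hm) htl hξ hη),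
    point_mem_Ico hβ hm (marked_mem (isLetter_zero hβ hm) hη), ?_⟩
  -- Lower bound: insertion n / m + 1 bounds the waiting time of order n + 4m from below, as (n / m
  -- + 4) m ≤ n + 4m. Upper bound: with n / m = k + 3, insertion k + 1 already matches n digits, and
  -- m (k + 1) ≤ n.
  refine hlim (4 * m) _ _ (tendsto_log_add_div m) ?_ ?_
  · refine Eventually.of_forall fun n => ?_
    have h1 : (n / m + 1 + 3) * m ≤ n + 4 * m := by
      have := Nat.div_mul_le_self n m
      linarith
    refine coe_le_waitingRate (hQpos (n / m + 1)) ((hmono ?_).trans (le_log_insertionStart_mul hm _))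
      (le_waitingTime hβ hm hQ htl hξ hη ht0 hξ0 hη0 hηt h1)
    exact (Nat.lt_mul_div_succ n hm).le
  · filter_upwards [eventually_ge_atTop (3 * m), eventually_ge_atTop 1] with n hn hn1
    have h3 : 3 ≤ n / m := (Nat.le_div_iff_mul_le hm).2 hn
    obtain ⟨k, hk⟩ := Nat.exists_eq_add_of_le h3
    have h1 : n ≤ (k + 1 + 3) * m := by
      have := Nat.lt_mul_div_succ n hm
      rw [hk] at this
      linarith
    have h2 : m * (k + 1) ≤ n := by
      have := Nat.mul_div_le n m
      rw [hk] at this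
      nlinarith
    rw [← add_div]
    refine waitingRate_le_coe (hQpos (k + 1)) ((log_insertionStart_mul_le h0 hm _).trans ?_)
      (waitingTime_le hβ hm hQ (by have := hQ1 0; omega) htl hξ hη h1)
    have h4 : ((k + 1 : ℕ) : ℝ) ≤ n := by
      have : k + 1 ≤ n := le_trans (Nat.le_mul_of_pos_left _ hm) h2
      exact_mod_cast this
    have h5 := hmono h2
    have h6 : Real.log (((k + 1 : ℕ) : ℝ) + 4) ≤ Real.log (n + 4) :=
      Real.log_le_log (by positivity) (by linarith)
    linarith

/-! ### Hölder maps and the Hausdorff dimension -/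

open scoped NNReal ENNReal in
/-- If `G d ↦ H d` is Hölder with exponent `r`, then the range of `H` has at most `1 / r` times
the Hausdorff dimension of the range of `G`. -/
theorem dimH_range_le_of_edist_le {D X Y : Type*} [Nonempty D] [EMetricSpace X] [EMetricSpace Y]
    {G : D → X} {H : D → Y} {C r : ℝ≥0} (hr : 0 < r)
    (h : ∀ d d', edist (H d) (H d') ≤ C * edist (G d) (G d') ^ (r : ℝ)) :
    dimH (range H) ≤ dimH (range G) / r := by
  have hinv : ∀ d, G (Function.invFun G (G d)) = G d := fun d =>
    Function.invFun_eq ⟨d, rfl⟩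
  have hH : ∀ d, H (Function.invFun G (G d)) = H d := fun d => by
    have := h (Function.invFun G (G d)) d
    rw [hinv, edist_self, ENNReal.zero_rpow_of_pos (by exact_mod_cast hr), mul_zero] at this
    exact edist_eq_zero.1 (nonpos_iff_eq_zero.1 this)
  have himage : (fun x => H (Function.invFun G x)) '' range G = range H := by
    rw [← range_comp]
    exact congrArg range (funext hH)
  rw [← himage]
  refine HolderOnWith.dimH_image_le (C := C) ?_ hr
  rintro _ ⟨d, rfl⟩ _ ⟨d', rfl⟩
  simp only [hH]
  exact h d d'

open scoped NNReal in
theorem edist_le_of_dist_le {X Y : Type*} [PseudoMetricSpace X] [PseudoMetricSpace Y] {x x' : X}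
    {y y' : Y} {K r : ℝ≥0} (h : dist y y' ≤ K * dist x x' ^ (r : ℝ)) :
    edist y y' ≤ K * edist x x' ^ (r : ℝ) := by
  rw [edist_dist, edist_dist, ENNReal.ofReal_rpow_of_nonneg dist_nonneg r.coe_nonneg,
    ← ENNReal.ofReal_coe_nnreal, ← ENNReal.ofReal_mul K.coe_nonneg]
  exact ENNReal.ofReal_le_ofReal h

/-- The part of the blocks below `q` that is taken up by insertions is negligible. -/
theorem mul_sub_le_count_not_inserted {Q : ℕ → ℕ} (hQm : Monotone Q)
    (hQ : ∀ n, (n + 4) ^ 3 ≤ Q n) [DecidablePred fun p => ¬ Inserted Q p] {ε : ℝ} (hε : 0 < ε)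
    (q : ℕ) : (1 - ε) * q - 1 / ε ^ 2 ≤ Nat.count (fun p => ¬ Inserted Q p) q := by
  classical
  -- For the least such K only the insertions before the K-th meet [0, q). They fill at most K (K +
  -- 3) blocks, while Q (K - 1) < q gives (K + 3)³ ≤ q if K > 0.
  have hex : ∃ K, q ≤ Q K := ⟨q, le_trans (by nlinarith [sq_nonneg q, Nat.zero_le q]) (hQ q)⟩
  have hK := Nat.find_spec hex
  have hKmin : ∀ k < Nat.find hex, Q k < q := fun k hk => not_le.1 (Nat.find_min hex hk)
  generalize Nat.find hex = K at hK hKmin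
  have hsub : (Finset.range q).filter (fun p => ¬ ¬ Inserted Q p) ⊆
      (Finset.range K).biUnion fun n => Finset.Ico (Q n) (Q n + n + 4) := by
    intro p hp
    simp only [Finset.mem_filter, Finset.mem_range, not_not] at hp
    obtain ⟨hpq, n, h1, h2⟩ := hp
    simp only [Finset.mem_biUnion, Finset.mem_range, Finset.mem_Ico]
    refine ⟨n, ?_, h1, h2⟩
    by_contra! hn
    have := hQm hn
    omega
  have hcard : ((Finset.range q).filter (fun p => ¬ ¬ Inserted Q p)).card ≤ K * (K + 3) := by
    refine (Finset.card_le_card hsub).trans ((Finset.card_biUnion_le_card_mul _ _ (K + 3) ?_).trans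
      (by rw [Finset.card_range]))
    intro n hn
    have := Finset.mem_range.1 hn
    rw [Nat.card_Ico]
    omega
  have hadd := Finset.card_filter_add_card_filter_not (s := Finset.range q)
    (fun p => ¬ Inserted Q p)
  rw [Finset.card_range, ← Nat.count_eq_card_filter_range] at hadd
  have hq : q ≤ Nat.count (fun p => ¬ Inserted Q p) q + K * (K + 3) := by omega
  have hqr : (q : ℝ) ≤ Nat.count (fun p => ¬ Inserted Q p) q + K * (K + 3) := by exact_mod_cast hq
  suffices hs : (K : ℝ) * (K + 3) ≤ ε * q + 1 / ε ^ 2 by linarith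
  rcases Nat.eq_zero_or_pos K with rfl | hKpos
  · simp only [Nat.cast_zero, zero_mul]
    positivity
  have hcube : ((K : ℝ) + 3) ^ 3 ≤ q := by
    have h1 := (hQ (K - 1)).trans (hKmin (K - 1) (by omega)).le
    rw [show K - 1 + 4 = K + 3 by omega] at h1
    exact_mod_cast h1
  have hle : (K : ℝ) * (K + 3) ≤ (K + 3) ^ 2 := by nlinarith [K.cast_nonneg (α := ℝ)]
  have hx0 : (0 : ℝ) < K + 3 := by positivity
  -- The square of K + 3 is at most ε times its cube, hence at most εq, or else at most 1 / ε².
  rcases le_total 1 (ε * (K + 3)) with h1 | h1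
  · have : ((K : ℝ) + 3) ^ 2 * 1 ≤ (K + 3) ^ 2 * (ε * (K + 3)) := by gcongr
    have h3 : ε * ((K : ℝ) + 3) ^ 3 ≤ ε * q := by gcongr
    have : 0 < 1 / ε ^ 2 := by positivity
    nlinarith
  · have h2 : ((K : ℝ) + 3) ^ 2 ≤ 1 / ε ^ 2 := by
      rw [le_div_iff₀ (by positivity), ← mul_pow, mul_comm]
      exact pow_le_one₀ (by positivity) h1
    have : 0 ≤ ε * (q : ℝ) := by positivity
    linarith

theorem infinite_not_inserted {Q : ℕ → ℕ} (hQm : Monotone Q) (hQ : ∀ n, (n + 4) ^ 3 ≤ Q n) :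
    {p | ¬ Inserted Q p}.Infinite := by
  classical
  intro hfin
  obtain ⟨q, hq⟩ := exists_nat_gt (2 * (hfin.toFinset.card + 4 : ℝ))
  have h1 := mul_sub_le_count_not_inserted hQm hQ (ε := 1 / 2) (by norm_num) q
  have h2 : Nat.count (fun p => ¬ Inserted Q p) q ≤ hfin.toFinset.card := by
    rw [Nat.count_eq_card_filter_range]
    refine Finset.card_le_card fun p hp => ?_
    simpa using (Finset.mem_filter.1 hp).2
  have h3 : (Nat.count (fun p => ¬ Inserted Q p) q : ℝ) ≤ hfin.toFinset.card := by
    exact_mod_cast h2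
  norm_num at h1
  linarith

/-- One factor s of the exponent comes from the size N of the alphabet, the other from the density
of the blocks that carry free letters. -/
theorem inv_pow_le_rpow {ρ δ s C d N : ℝ} {q n : ℕ} (hρ : 0 < ρ) (hρ1 : ρ < 1) (hδ : 0 < δ)
    (hs : 0 < s) (hN : ρ ^ (-s) ≤ N) (hqn : s * q - C ≤ n) (hd : δ * ρ ^ (q + 1) ≤ d) :
    (N ^ n)⁻¹ ≤ ρ ^ (-(s * (s + C))) * δ ^ (-(s * s)) * d ^ (s * s) := by
  have h1 : (N ^ n)⁻¹ ≤ ρ ^ (s * n) := by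
    rw [inv_le_comm₀ (pow_pos ((by positivity : 0 < ρ ^ (-s)).trans_le hN) n) (by positivity),
      ← Real.rpow_neg hρ.le, ← neg_mul, Real.rpow_mul_natCast hρ.le]
    gcongr
  have h2 : ρ ^ (s * n) ≤ ρ ^ (s * (s * q - C)) :=
    Real.rpow_le_rpow_of_exponent_ge hρ hρ1.le (by gcongr)
  have h3 : ρ ^ (s * (s * q - C)) =
      ρ ^ (-(s * (s + C))) * δ ^ (-(s * s)) * (δ * ρ ^ (q + 1)) ^ (s * s) := by
    rw [Real.mul_rpow hδ.le (by positivity), ← Real.rpow_natCast ρ, ← Real.rpow_mul hρ.le]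
    calc ρ ^ (s * (s * q - C)) = ρ ^ (-(s * (s + C)) + ((q + 1 : ℕ) : ℝ) * (s * s)) *
          δ ^ (-(s * s) + s * s) := by
          rw [neg_add_cancel, Real.rpow_zero, mul_one]
          congr 1
          push_cast
          ring
      _ = _ := by
          rw [Real.rpow_add hρ, Real.rpow_add hδ]
          ring
  rw [h3] at h2
  refine h1.trans (h2.trans ?_)
  gcongr

/-- Real numbers in base `N` depend in a Hölder way on separated points with the same digits. -/
theorem abs_ofDigits_sub_le {N : ℕ} {x x' : ℝ} {i i' : ℕ → Fin N} {ρ δ s C : ℝ} (hρ : 0 < ρ)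
    (hρ1 : ρ < 1) (hδ : 0 < δ) (hs : 0 < s) (hN : ρ ^ (-s) ≤ N)
    (h : ∀ n, i n ≠ i' n → ∃ q : ℕ, s * q - C ≤ n ∧ δ * ρ ^ (q + 1) ≤ |x - x'|) :
    |Real.ofDigits i - Real.ofDigits i'| ≤
      ρ ^ (-(s * (s + C))) * δ ^ (-(s * s)) * |x - x'| ^ (s * s) := by
  classical
  by_cases hex : ∃ n, i n ≠ i' n
  · obtain ⟨q, h1, h2⟩ := h _ (Nat.find_spec hex)
    exact (Real.abs_ofDigits_sub_ofDigits_le fun k hk => not_not.1 (Nat.find_min hex hk)).trans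
      (inv_pow_le_rpow hρ hρ1 hδ hs hN h1 h2)
  · push Not at hex
    rw [funext hex, sub_self, abs_zero]
    positivity

theorem dimH_range_ofDigits_prod {N : ℕ} (hN : 2 ≤ N) :
    dimH (range fun d : (ℕ → Fin N) × (ℕ → Fin N) =>
      (Real.ofDigits d.1, Real.ofDigits d.2)) = 2 := by
  have hsub : Icc (0 : ℝ) 1 ×ˢ Icc (0 : ℝ) 1 ⊆ range fun d : (ℕ → Fin N) × (ℕ → Fin N) =>
      (Real.ofDigits d.1, Real.ofDigits d.2) := by
    rintro ⟨x, y⟩ ⟨hx, hy⟩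
    obtain ⟨i, -, hi⟩ := Real.ofDigits_SurjOn (by omega : 1 < N) hx
    obtain ⟨j, -, hj⟩ := Real.ofDigits_SurjOn (by omega : 1 < N) hy
    exact ⟨(i, j), Prod.ext hi hj⟩
  have hnonempty : (interior (range fun d : (ℕ → Fin N) × (ℕ → Fin N) =>
      (Real.ofDigits d.1, Real.ofDigits d.2))).Nonempty := by
    refine Nonempty.mono (interior_mono hsub) ?_
    rw [interior_prod_eq, interior_Icc]
    exact ⟨(1 / 2, 1 / 2), by norm_num, by norm_num⟩
  rw [Real.dimH_of_nonempty_interior hnonempty]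
  simp

theorem two_mul_le_dimH_waitingSet (hβ : 1 < β) {a b : EReal} (ha : 0 ≤ a) (hab : a ≤ b) {s : ℝ}
    (hs0 : 0 < s) (hs1 : s < 1) : 2 * ENNReal.ofReal (s * s) ≤ dimH (waitingSet β a b) := by
  classical
  have hβ0 : 0 < β := by linarith
  obtain ⟨m, N, hm, hN2, hN, e, t, hinj, hel, he0, htl, ht0, het⟩ := exists_letters hβ hs1
  obtain ⟨Q, hQ, hQ3, hmem⟩ := exists_insertions hβ ha hab hm
  have hQm := (strictMono_of_add_le hQ).monotone
  have hinf := infinite_not_inserted hQm hQ3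
  have : Nonempty (Fin N) := ⟨⟨0, by omega⟩⟩
  set ρ := (β ^ m)⁻¹ with hρ
  have hρ0 : 0 < ρ := by positivity
  have hρ1 : ρ < 1 := inv_pow_lt_one hβ hm
  have hδ : 0 < 1 - β⁻¹ := by linarith [inv_lt_one_of_one_lt₀ hβ]
  have hNρ : ρ ^ (-s) ≤ N := by
    rwa [hρ, Real.inv_rpow (by positivity), Real.rpow_neg (by positivity), inv_inv]
  -- The first summand is the loss to insertions in x for ε = 1 - s, the second pays for the two
  -- zero letters that open y.
  set C := 1 / (1 - s) ^ 2 + 2 with hC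
  have hC0 : 0 < 1 / (1 - s) ^ 2 := by
    have : 0 < 1 - s := by linarith
    positivity
  set K := ρ ^ (-(s * (s + C))) * (1 - β⁻¹) ^ (-(s * s)) with hK
  have hK0 : 0 ≤ K := by positivity
  set G : (ℕ → Fin N) × (ℕ → Fin N) → ℝ × ℝ := fun d =>
    (point β m (layout Q t (e ∘ d.1) (e ∘ d.2)), point β m (marked (e ∘ d.2))) with hG
  have hGsub : range G ⊆ waitingSet β a b := by
    rintro _ ⟨d, rfl⟩
    exact hmem t _ _ htl (fun r => hel _) (fun r => hel _) ht0 (fun r => he0 _) (fun r => he0 _)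
      fun r => het _
  have hx : ∀ d : (ℕ → Fin N) × (ℕ → Fin N), ∀ q,
      IsLetter β m (layout Q t (e ∘ d.1) (e ∘ d.2) q) := fun d =>
    layout_mem (isLetter_zero hβ hm) htl (fun r => hel _) fun r => hel _
  have hy : ∀ d : (ℕ → Fin N) × (ℕ → Fin N), ∀ q, IsLetter β m (marked (e ∘ d.2) q) := fun d =>
    marked_mem (isLetter_zero hβ hm) fun r => hel _
  have hholder : ∀ d d' : (ℕ → Fin N) × (ℕ → Fin N),
      dist (Real.ofDigits d.1, Real.ofDigits d.2) (Real.ofDigits d'.1, Real.ofDigits d'.2) ≤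
        K * dist (G d) (G d') ^ (s * s) := by
    intro d d'
    rw [Prod.dist_eq]
    refine max_le ?_ ?_
    · have h1 : |Real.ofDigits d.1 - Real.ofDigits d'.1| ≤ K * |(G d).1 - (G d').1| ^ (s * s) := by
        refine abs_ofDigits_sub_le hρ0 hρ1 hδ hs0 hNρ fun n hn => ?_
        -- The n-th free block carries the n-th letter of ξ. A disagreement there separates the
        -- first coordinates, whatever the inserted letters of η do before it.
        have hfree := Nat.nth_mem_of_infinite hinf n
        have hcount := Nat.count_nth_of_infinite hinf n
        refine ⟨Nat.nth (fun p => ¬ Inserted Q p) n, ?_,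
          abs_point_sub_point_ge hβ hm (hx d) (hx d') ?_⟩
        · have h2 := mul_sub_le_count_not_inserted hQm hQ3 (ε := 1 - s) (by linarith)
            (Nat.nth (fun p => ¬ Inserted Q p) n)
          rw [hcount, sub_sub_cancel] at h2
          linarith
        · rw [layout_of_not_inserted hfree, layout_of_not_inserted hfree, hcount]
          exact fun h => hn (hinj h)
      refine h1.trans ?_
      gcongr
      exact le_max_left _ _
    · have h1 : |Real.ofDigits d.2 - Real.ofDigits d'.2| ≤ K * |(G d).2 - (G d').2| ^ (s * s) := by
        refine abs_ofDigits_sub_le hρ0 hρ1 hδ hs0 hNρ fun n hn => ?_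
        refine ⟨n + 2, ?_, abs_point_sub_point_ge hβ hm (hy d) (hy d') ?_⟩
        · push_cast
          have : (0 : ℝ) ≤ n := n.cast_nonneg
          nlinarith
        · simp only [marked, Nat.add_sub_cancel, if_neg (by omega : ¬ n + 2 < 2)]
          exact fun h => hn (hinj h)
      refine h1.trans ?_
      gcongr
      exact le_max_right _ _
  have hr : 0 < Real.toNNReal (s * s) := by
    rw [Real.toNNReal_pos]; positivity
  have hdim := dimH_range_le_of_edist_le (C := K.toNNReal) (r := Real.toNNReal (s * s)) (G := G)
    (H := fun d : (ℕ → Fin N) × (ℕ → Fin N) => (Real.ofDigits d.1, Real.ofDigits d.2)) hr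
    fun d d' => by
      refine edist_le_of_dist_le ?_
      rw [Real.coe_toNNReal K hK0, Real.coe_toNNReal (s * s) (by positivity)]
      exact hholder d d'
  rw [dimH_range_ofDigits_prod hN2, ENNReal.le_div_iff_mul_le (by simp [hs0.ne'])
    (by simp)] at hdim
  exact hdim.trans (dimH_mono hGsub)

end BetaWaiting

end

theorem theorem1 (β : ℝ) (hβ : 1 < β) (a b : EReal) (ha : 0 ≤ a) (hab : a ≤ b) :
    dimH (BetaWaiting.waitingSet β a b) = 2 := by
  refine le_antisymm ?_ ?_
  · calc dimH (BetaWaiting.waitingSet β a b) ≤ dimH (Set.univ : Set (ℝ × ℝ)) :=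
          dimH_mono (Set.subset_univ _)
      _ = 2 := by rw [Real.dimH_univ_eq_finrank]; simp
  -- The lower bound 2s² holds for every s in (0, 1); let s tend to 1 from below.
  · have hlim : Filter.Tendsto (fun s : ℝ => 2 * ENNReal.ofReal (s * s)) (nhdsWithin 1 (Set.Iio 1))
        (nhds (2 * ENNReal.ofReal (1 * 1))) := by
      refine ENNReal.Tendsto.const_mul (ENNReal.tendsto_ofReal ?_) (Or.inr (by simp))
      exact ((continuous_id.mul continuous_id).tendsto (1 : ℝ)).mono_left nhdsWithin_le_nhds
    rw [mul_one, ENNReal.ofReal_one, mul_one] at hlim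
    refine le_of_tendsto hlim ?_
    filter_upwards [Ioo_mem_nhdsLT (zero_lt_one' ℝ)] with s hs
    exact BetaWaiting.two_mul_le_dimH_waitingSet hβ ha hab hs.1 hs.2
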